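/- Let $n\ge 1$. Put $\mathcal R_n=\mathbb Z_{(2)}[\gamma^j t_i : i\ge 1,\ 0\le j<2^{n-1}]$ (this is $\pi_*^e BP^{((C_{2^n}))}$), with the action of the cyclic group $C_{2^n}=\langle\gamma_n\rangle$ by $\mathbb Z_{(2)}$-algebra automorphisms in which $\gamma_n(\gamma^jt_i)=\gamma^{j+1}t_i$ for $j<2^{n-1}-1$ and $\gamma_n(\gamma^{2^{n-1}-1}t_i)=-t_i$; extend the action $\mathbb Q$-linearly to $\mathcal R_n\otimes\mathbb Q$, and for $1\le r\le n$ put $\gamma_r=\gamma_n^{2^{n-r}}$. For a formal group law $F$ over $\mathcal R_n$ let $F^{\gamma}$ be obtained by applying $\gamma=\gamma_n$ to its coefficients, write $\sum^{F}$ for sums formed with $F$, and put $t_0=1$. There is exactly one commutative one-dimensional formal group law $\mathcal F$ over $\mathcal R_n$ such that * $\mathcal F$ is $2$-typical, i.e. it has a logarithm over $\mathcal R_n\otimes\mathbb Q$ of the form $\log_{\mathcal F}(x)=x+\sum_{i\ge1}\ell_i x^{2^i}$; * the series $\psi_\gamma(x)=\sum^{\mathcal F^{\gamma}}_{i\ge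 0}t_i x^{2^i}$ is a strict isomorphism $\mathcal F\to\mathcal F^{\gamma}$; * the composite of the strict isomorphisms $(\gamma^{i})^*\psi_\gamma:\mathcal F^{\gamma^i}\to\mathcal F^{\gamma^{i+1}}$, $0\le i\le 2^{n-1}-1$, is the conjugation isomorphism $x\mapsto-[-1]_{\mathcal F}(x)$. The coefficients $\ell_i\in\mathcal R_n\otimes\mathbb Q$ of its logarithm are uniquely determined, and there are unique elements $v_i\in\mathcal R_n$ ($i\ge 0$), the Araki generators, with $[2]_{\mathcal F}(x)=\sum^{\mathcal F}_{i\ge0}v_i x^{2^i}$. For $k\ge1$ let $I_k=(2,v_1,\dots,v_{k-1})\subseteq\mathcal R_n$ and, for $1\le r\le n$, let $\gamma_rL_k$ be the $\mathcal R_n$-submodule of $\mathcal R_n\otimes\mathbb Q$ generated by $2,\gamma_r\ell_1,\dots,\gamma_r\ell_{k-1}$. Then for all $k\ge 1$: 1. $v_k-\gamma_nv_k\in I_k$; 2. $g\,I_k=I_k$ for every $g\in C_{2^n}$; 3. $\gamma_rL_k\cap\mathcal R_n=I_k$ for every $1\le r\le n$. -/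

import Mathlib

attribute [local instance] MvPolynomial.algebraMvPolynomial

namespace EquivariantBP

/-! ### Formal group laws: homomorphisms, formal sums, inverses -/

section FormalGroupLaws

variable {A : Type*} [CommRing A]

/-- The substitution `F(f, g)`, i.e. the formal sum `f +_F g`. -/
noncomputable def fAdd {τ : Type*} (F : FormalGroup A) (f g : MvPowerSeries τ A) :
    MvPowerSeries τ A :=
  MvPowerSeries.subst ![f, g] F.toPowerSeries

/-- `ψ : F → G` is a strict homomorphism of formal group laws:
`ψ(x) = x + ⋯` and `ψ(F(x, y)) = G(ψ(x), ψ(y))`.  Strict homomorphisms are automatically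
isomorphisms. -/
structure IsStrictHom (F G : FormalGroup A) (ψ : PowerSeries A) : Prop where
  coeff_zero : PowerSeries.coeff 0 ψ = 0
  coeff_one : PowerSeries.coeff 1 ψ = 1
  hom : PowerSeries.subst F.toPowerSeries ψ =
    fAdd G (PowerSeries.subst (MvPowerSeries.X 0 : MvPowerSeries (Fin 2) A) ψ)
      (PowerSeries.subst (MvPowerSeries.X 1 : MvPowerSeries (Fin 2) A) ψ)

/-- The formal sum of the terms `c i * x ^ (2 ^ i)` for `i < m`, taken with respect to `F`. -/
noncomputable def formalPartialSum (F : FormalGroup A) (c : ℕ → A) : ℕ → PowerSeries A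
  | 0 => 0
  | m + 1 => fAdd F (formalPartialSum F c m) (PowerSeries.monomial (2 ^ m) (c m))

/-- The infinite formal sum `∑^F_{i ≥ 0} c i * x ^ (2 ^ i)`.  The coefficient of `x ^ d` in the
partial sums is constant from the `d + 1`-st one on, since `d < 2 ^ i` for `i ≥ d`. -/
noncomputable def formalSum (F : FormalGroup A) (c : ℕ → A) : PowerSeries A :=
  PowerSeries.mk fun d => PowerSeries.coeff d (formalPartialSum F c (d + 1))

/-- `ι` is the formal inversion `[-1]_F`: `ι(0) = 0` and `F(x, ι(x)) = 0`. -/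
def IsInversion (F : FormalGroup A) (ι : PowerSeries A) : Prop :=
  PowerSeries.coeff 0 ι = 0 ∧ fAdd F PowerSeries.X ι = 0

/-- The series `∑_{i ≥ 0} c i * x ^ (2 ^ i)` (ordinary sum). -/
noncomputable def twoSeries (c : ℕ → A) : PowerSeries A :=
  PowerSeries.mk fun d => if d = 2 ^ Nat.log 2 d then c (Nat.log 2 d) else 0

/-- `v` is the sequence of Araki elements of `F`: `[2]_F(x) = ∑^F_{i ≥ 0} v i * x ^ (2 ^ i)`. -/
def IsAraki (F : FormalGroup A) (v : ℕ → A) : Prop :=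
  fAdd F PowerSeries.X PowerSeries.X = formalSum F v

/-- `ℓ` is the sequence of coefficients of a logarithm of the form `∑ ℓ i * x ^ (2 ^ i)` of `F`,
with values in an `A`-algebra `B` (to be used with `B = A ⊗ ℚ`). -/
def IsLogCoeffs {B : Type*} [CommRing B] [Algebra A B] (F : FormalGroup A) (ℓ : ℕ → B) : Prop :=
  IsStrictHom (F.map (algebraMap A B)) FormalGroup.𝔾ₐ (twoSeries ℓ)

end FormalGroupLaws

/-! ### The ring `R_n` with its action of the cyclic group of order `2 ^ n` -/

/-- The ring `ℤ_(2)` of rational numbers with odd denominator. -/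
def Z2 : Subring ℚ where
  carrier := {q | Odd q.den}
  mul_mem' {a b} ha hb := Odd.of_dvd_nat (Odd.mul ha hb) (Rat.mul_den_dvd a b)
  one_mem' := by simp
  add_mem' {a b} ha hb := Odd.of_dvd_nat (Odd.mul ha hb) (Rat.add_den_dvd a b)
  zero_mem' := by simp
  neg_mem' {a} ha := by simpa using ha

/-- The polynomial ring over `K` on generators `γ ^ j t_i` (`i ≥ 1`, `0 ≤ j < 2 ^ (n - 1)`).
The variable with index `(i, j)` is `γ ^ j t_{i + 1}`. -/
abbrev Poly (n : ℕ) (K : Type) [CommRing K] : Type :=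
  MvPolynomial (ℕ × Fin (2 ^ (n - 1))) K

/-- `R_n = ℤ_(2)[C_{2^n} · t_1, C_{2^n} · t_2, …]`. -/
abbrev R (n : ℕ) : Type := Poly n Z2

/-- `R_n ⊗ ℚ = ℚ[C_{2^n} · t_1, C_{2^n} · t_2, …]`. -/
abbrev RQ (n : ℕ) : Type := Poly n ℚ

section Action

variable (n : ℕ) (K : Type) [CommRing K]

/-- The `K`-algebra endomorphism `γ_n`: `γ ^ j t_i ↦ γ ^ (j + 1) t_i` for `j < 2 ^ (n - 1) - 1`, and
`γ ^ j t_i ↦ - t_i` for `j = 2 ^ (n - 1) - 1`. -/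
noncomputable def gammaHom : Poly n K →ₐ[K] Poly n K :=
  MvPolynomial.aeval fun p =>
    if h : p.2.val + 1 < 2 ^ (n - 1) then MvPolynomial.X (p.1, ⟨p.2.val + 1, h⟩)
    else - MvPolynomial.X (p.1, ⟨0, by positivity⟩)

/-- The element `γ ^ a t_{i+1}` for arbitrary `a`. -/
noncomputable def gen (i a : ℕ) : Poly n K :=
  (-1) ^ (a / 2 ^ (n - 1)) *
    MvPolynomial.X (i, ⟨a % 2 ^ (n - 1), Nat.mod_lt _ (by positivity)⟩)

theorem gammaHom_gen (i a : ℕ) : gammaHom n K (gen n K i a) = gen n K i (a + 1) := by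
  have hN : 0 < 2 ^ (n - 1) := by positivity
  have hlt := Nat.mod_lt a hN
  have hda := Nat.div_add_mod a (2 ^ (n - 1))
  unfold gen gammaHom
  simp only [map_mul, map_pow, map_neg, map_one, MvPolynomial.aeval_X]
  split_ifs with h
  · have h0 : a + 1 = (a % 2 ^ (n - 1) + 1) + 2 ^ (n - 1) * (a / 2 ^ (n - 1)) := by lia
    have h1 : (a + 1) / 2 ^ (n - 1) = a / 2 ^ (n - 1) := by
      rw [h0, Nat.add_mul_div_left _ _ hN, Nat.div_eq_of_lt h, zero_add]
    have h2 : (a + 1) % 2 ^ (n - 1) = a % 2 ^ (n - 1) + 1 := by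
      conv_lhs => rw [h0, Nat.add_mul_mod_self_left, Nat.mod_eq_of_lt h]
    simp only [h1, h2]
  · have h0 : a + 1 = 2 ^ (n - 1) * (a / 2 ^ (n - 1) + 1) := by rw [mul_add]; lia
    have h1 : (a + 1) / 2 ^ (n - 1) = a / 2 ^ (n - 1) + 1 := by
      rw [h0, Nat.mul_div_cancel_left _ hN]
    have h2 : (a + 1) % 2 ^ (n - 1) = 0 := by
      rw [h0, Nat.mul_mod_right]
    simp only [h1, h2]
    ring

theorem gammaHom_pow_gen (m i a : ℕ) :
    (gammaHom n K ^ m) (gen n K i a) = gen n K i (a + m) := by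
  induction m with
  | zero => simp
  | succ m ih =>
    rw [pow_succ', AlgHom.mul_apply, ih, gammaHom_gen, add_assoc]

theorem gammaHom_pow_order : gammaHom n K ^ (2 * 2 ^ (n - 1)) = 1 := by
  have hN : 0 < 2 ^ (n - 1) := by positivity
  apply MvPolynomial.algHom_ext
  rintro ⟨i, j⟩
  have hj : (MvPolynomial.X (i, j) : Poly n K) = gen n K i j.val := by
    unfold gen
    simp [Nat.div_eq_of_lt j.isLt, Nat.mod_eq_of_lt j.isLt]
  rw [hj, gammaHom_pow_gen, AlgHom.one_apply]
  unfold gen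
  simp only [Nat.add_mul_div_right _ _ hN, Nat.add_mul_mod_self_right]
  rw [pow_add]
  simp

/-- The automorphism `γ_n` of order `2 ^ n` (for `n ≥ 1`), the generator of the action
of `C_{2^n}`. -/
noncomputable def gamma : Poly n K ≃ₐ[K] Poly n K :=
  AlgEquiv.ofAlgHom (gammaHom n K) (gammaHom n K ^ (2 * 2 ^ (n - 1) - 1))
    (by
      have hN : 0 < 2 ^ (n - 1) := by positivity
      change gammaHom n K * gammaHom n K ^ (2 * 2 ^ (n - 1) - 1) = 1
      rw [← pow_succ', Nat.sub_add_cancel (by lia), gammaHom_pow_order])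
    (by
      have hN : 0 < 2 ^ (n - 1) := by positivity
      change gammaHom n K ^ (2 * 2 ^ (n - 1) - 1) * gammaHom n K = 1
      rw [← pow_succ, Nat.sub_add_cancel (by lia), gammaHom_pow_order])

/-- For `r ≤ n`, the generator `γ_r = γ_n ^ (2 ^ (n - r))` of the subgroup `C_{2^r}`. -/
noncomputable def gammaSub (r : ℕ) : Poly n K ≃ₐ[K] Poly n K :=
  gamma n K ^ (2 ^ (n - r))

end Action

/-! ### The formal group law over `R_n` -/

/-- The elements `t_0 = 1` and `t_i` (`i ≥ 1`) of `R_n`. -/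
noncomputable def t (n : ℕ) : ℕ → R n
  | 0 => 1
  | i + 1 => MvPolynomial.X (i, ⟨0, by positivity⟩)

/-- The conjugate formal group law `F ^ γ`, where `γ` is applied to the coefficients of `F`. -/
noncomputable def conj {n : ℕ} (F : FormalGroup (R n)) : FormalGroup (R n) :=
  F.map (gamma n Z2 : R n →+* R n)

/-- The power series `ψ_γ(x) = x +_{F^γ} ∑^{F^γ}_{i ≥ 1} t_i x ^ (2 ^ i)`. -/
noncomputable def psi {n : ℕ} (F : FormalGroup (R n)) : PowerSeries (R n) :=
  formalSum (conj F) (t n)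

/-- The composite of `(γ ^ i)^* ψ_γ : F ^ (γ ^ i) → F ^ (γ ^ (i + 1))` for `0 ≤ i < m`. -/
noncomputable def psiComp {n : ℕ} (F : FormalGroup (R n)) : ℕ → PowerSeries (R n)
  | 0 => PowerSeries.X
  | i + 1 => PowerSeries.subst (psiComp F i)
      (PowerSeries.map ((gamma n Z2 ^ i : R n ≃ₐ[Z2] R n) : R n →+* R n) (psi F))

/-- The properties that single out the canonical formal group law over
`R_n = π_*^e BP^{((C_{2^n}))}`: it is a commutative formal group law, it is `2`-typical (its
logarithm over `R_n ⊗ ℚ` has the form `∑ ℓ_i x ^ (2 ^ i)`), the series `ψ_γ` formed with the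
generators `t_i` is a strict isomorphism `F → F ^ γ`, and the composite of
`ψ_γ, γ^* ψ_γ, …, (γ ^ (2 ^ (n - 1) - 1))^* ψ_γ` is the conjugation isomorphism `-[-1]_F(x)`. -/
structure IsCanonicalLaw (n : ℕ) (F : FormalGroup (R n)) : Prop where
  comm : F.IsComm
  typical : ∃ ℓ : ℕ → RQ n, IsLogCoeffs F ℓ
  strict : IsStrictHom F (conj F) (psi F)
  inversion : IsInversion F (- psiComp F (2 ^ (n - 1)))

/-! ### The ideals `I_k` and the modules `γ_r L_k` -/

/-- `I_k = (2, v_1, …, v_{k-1})`. -/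
noncomputable def idealI {n : ℕ} (v : ℕ → R n) (k : ℕ) : Ideal (R n) :=
  Ideal.span (insert 2 (v '' Set.Ico 1 k))

/-- The `R_n`-submodule `g L_k` of `R_n ⊗ ℚ` generated by `2, g ℓ_1, …, g ℓ_{k-1}`. -/
noncomputable def moduleL {n : ℕ} (ℓ : ℕ → RQ n) (g : RQ n ≃ₐ[ℚ] RQ n) (k : ℕ) : Submodule (R n) (RQ n) :=
  Submodule.span (R n) (insert 2 ((fun i => g (ℓ i)) '' Set.Ico 1 k))

end EquivariantBP

namespace EquivariantBP

open Finset

/-! ### Sequences of functional equation type -/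

section FunctionalEquation

/-- Associativity of summation over triples with a given sum. -/
theorem sum_antidiagonal_assoc {M : Type*} [AddCommMonoid M] (k : ℕ) (f : ℕ → ℕ → ℕ → M) :
    ∑ p ∈ antidiagonal k, ∑ q ∈ antidiagonal p.1, f q.1 q.2 p.2 =
      ∑ p ∈ antidiagonal k, ∑ q ∈ antidiagonal p.2, f p.1 q.1 q.2 := by
  rw [Finset.sum_sigma', Finset.sum_sigma']
  refine Finset.sum_nbij' (fun x => ⟨(x.2.1, x.2.2 + x.1.2), (x.2.2, x.1.2)⟩)
    (fun x => ⟨(x.1.1 + x.2.1, x.2.2), (x.1.1, x.2.1)⟩) ?_ ?_ ?_ ?_ ?_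
  all_goals
    rintro ⟨⟨a, b⟩, ⟨c, d⟩⟩ h
    simp only [mem_sigma, HasAntidiagonal.mem_antidiagonal] at h
    obtain ⟨h1, h2⟩ := h
    subst h2
    simp <;> lia

theorem sum_antidiagonal_left_comm {M : Type*} [AddCommMonoid M] (k : ℕ) (f : ℕ → ℕ → ℕ → M) :
    ∑ p ∈ antidiagonal k, ∑ q ∈ antidiagonal p.2, f p.1 q.1 q.2 =
      ∑ p ∈ antidiagonal k, ∑ q ∈ antidiagonal p.2, f q.1 p.1 q.2 := by
  rw [← sum_antidiagonal_assoc, ← sum_antidiagonal_assoc k (fun a b c => f b a c)]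
  refine Finset.sum_congr rfl fun p _ => ?_
  rw [← Finset.Nat.sum_antidiagonal_swap]
  rfl

/-- The coefficients of `∑ i, f (c i * x ^ (2 ^ i))` for `f = ∑ j, f j * x ^ (2 ^ j)`. -/
def star {B : Type*} [CommRing B] (f c : ℕ → B) (k : ℕ) : B :=
  ∑ p ∈ antidiagonal k, f p.2 * c p.1 ^ 2 ^ p.2

/-- The `k`-th coefficient of `∑ a, w a * (σ ^ a) f (x ^ (2 ^ a))`. -/
def twist {B : Type*} [CommRing B] (σ : B →+* B) (w f : ℕ → B) (k : ℕ) : B :=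
  ∑ p ∈ antidiagonal k, w p.1 * (σ ^ p.1) (f p.2)

theorem map_star {B C : Type*} [CommRing B] [CommRing C] (g : B →+* C) (f c : ℕ → B) (k : ℕ) :
    g (star f c k) = star (fun i => g (f i)) (fun i => g (c i)) k := by
  simp [star]

/-- `σA` is a lift of the Frobenius modulo `2` and `σ` extends it along `φ`. -/
structure FrobeniusLift {A B : Type*} [CommRing A] [CommRing B] (φ : A →+* B) (σA : A →+* A)
    (σ : B →+* B) : Prop where
  comm : ∀ a, σ (φ a) = φ (σA a)
  frob : ∀ a, (2 : A) ∣ σA a - a ^ 2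

variable {A B : Type*} [CommRing A] [CommRing B] {φ : A →+* B} {σA : A →+* A} {σ : B →+* B}

theorem FrobeniusLift.comm_pow (H : FrobeniusLift φ σA σ) (i : ℕ) (a : A) :
    (σ ^ i) (φ a) = φ ((σA ^ i) a) := by
  induction i with
  | zero => rfl
  | succ i ih => simp only [pow_succ', RingHom.mul_def, RingHom.comp_apply, ih, H.comm]

theorem FrobeniusLift.pow_mem (H : FrobeniusLift φ σA σ) (i : ℕ) {b : B} (hb : b ∈ φ.range) :
    (σ ^ i) b ∈ φ.range := by
  obtain ⟨a, rfl⟩ := hb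
  exact ⟨_, (H.comm_pow i a).symm⟩

theorem FrobeniusLift.frob_pow (H : FrobeniusLift φ σA σ) (i : ℕ) (a : A) :
    (2 : A) ∣ (σA ^ i) a - a ^ 2 ^ i := by
  induction i with
  | zero => simp
  | succ i ih =>
    have h1 := H.frob ((σA ^ i) a)
    have h2 : (2 : A) ∣ ((σA ^ i) a) ^ 2 - (a ^ 2 ^ i) ^ 2 := ih.trans (sub_dvd_pow_sub_pow _ _ 2)
    rw [← pow_mul, ← pow_succ] at h2
    have h3 := dvd_add h1 h2
    rw [sub_add_sub_cancel] at h3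
    rwa [pow_succ' σA, RingHom.mul_def, RingHom.comp_apply]

theorem FrobeniusLift.frob_pow_pow (H : FrobeniusLift φ σA σ) (i j : ℕ) (a : A) :
    (2 : A) ^ (j + 1) ∣ ((σA ^ i) a) ^ 2 ^ j - a ^ 2 ^ (i + j) := by
  have h := dvd_sub_pow_of_dvd_sub (p := 2) (by exact_mod_cast H.frob_pow i a) j
  rw [← pow_mul, ← pow_add] at h
  exact_mod_cast h

theorem two_pow_mul_mem (H : FrobeniusLift φ σA σ) {w f : ℕ → B} {K : ℕ} (hw0 : w 0 = 1)
    (hw : ∀ a, 1 ≤ a → a < K → 2 * w a ∈ φ.range) (hf : ∀ j < K, twist σ w f j ∈ φ.range) :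
    ∀ j < K, 2 ^ j * f j ∈ φ.range := by
  intro j
  induction j using Nat.strong_induction_on with
  | _ j ih =>
  intro hj
  have h1 := hf j hj
  rcases j with _ | j
  · simpa [twist, hw0] using h1
  rw [twist, Finset.Nat.sum_antidiagonal_succ, hw0] at h1
  simp only [pow_zero, one_mul, RingHom.one_def, RingHom.id_apply] at h1
  have h2 : ∑ p ∈ antidiagonal j, 2 ^ (j + 1) * (w (p.1 + 1) * (σ ^ (p.1 + 1)) (f p.2)) ∈
      φ.range := by
    refine sum_mem fun p hp => ?_
    rw [HasAntidiagonal.mem_antidiagonal] at hp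
    have e : 2 ^ (j + 1) * (w (p.1 + 1) * (σ ^ (p.1 + 1)) (f p.2)) =
        2 ^ p.1 * ((2 * w (p.1 + 1)) * (σ ^ (p.1 + 1)) (2 ^ p.2 * f p.2)) := by
      rw [← hp, map_mul, map_pow, map_ofNat]; ring
    rw [e]
    exact mul_mem (pow_mem (ofNat_mem _ 2) _) (mul_mem (hw _ (by lia) (by lia))
      (H.pow_mem _ (ih p.2 (by lia) (by lia))))
  rw [← Finset.mul_sum] at h2
  have h3 := sub_mem (mul_mem (pow_mem (ofNat_mem φ.range 2) (j + 1)) h1) h2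
  rwa [mul_add, add_sub_cancel_right] at h3

theorem twist_smul_sub_mem (H : FrobeniusLift φ σA σ) {w f : ℕ → B} {k : ℕ}
    (hw : ∀ a, 1 ≤ a → a ≤ k → 2 * w a ∈ φ.range) (hf : ∀ j < k, 2 ^ j * f j ∈ φ.range) (x : A) :
    twist σ w (fun j => f j * φ x ^ 2 ^ j) k - φ x ^ 2 ^ k * twist σ w f k ∈ φ.range := by
  rw [twist, twist, Finset.mul_sum, ← Finset.sum_sub_distrib]
  refine sum_mem fun p hp => ?_
  rw [HasAntidiagonal.mem_antidiagonal] at hp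
  obtain ⟨a, b⟩ := p
  simp only at hp ⊢
  rcases Nat.eq_zero_or_pos a with rfl | ha
  · rw [zero_add] at hp
    subst hp
    simp only [pow_zero, RingHom.one_def, RingHom.id_apply]
    convert zero_mem φ.range using 1
    ring
  obtain ⟨z, hz⟩ := H.frob_pow_pow a b x
  have e : w a * (σ ^ a) (f b * φ x ^ 2 ^ b) - φ x ^ 2 ^ k * (w a * (σ ^ a) (f b)) =
      (2 * w a) * (σ ^ a) (2 ^ b * f b) * φ z := by
    have h2 := congrArg φ hz
    simp only [map_sub, map_mul, map_pow, map_ofNat] at h2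
    simp only [map_mul, map_pow, map_ofNat, H.comm_pow, ← hp]
    linear_combination (w a * (σ ^ a) (f b)) * h2
  rw [e]
  exact mul_mem (mul_mem (hw a ha (by lia)) (H.pow_mem _ (hf b (by lia)))) ⟨z, rfl⟩

theorem twist_star (w f c : ℕ → B) (k : ℕ) :
    twist σ w (star f c) k =
      ∑ p ∈ antidiagonal k, twist σ w (fun j => f j * c p.1 ^ 2 ^ j) p.2 := by
  simp only [twist, star, map_sum, Finset.mul_sum]
  exact sum_antidiagonal_left_comm k
    (fun a i j => w a * (σ ^ a) (f j * c i ^ 2 ^ j))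

theorem twist_star_sub_mem (H : FrobeniusLift φ σA σ) {w g : ℕ → B} {k : ℕ} (hw0 : w 0 = 1)
    (hw : ∀ a, 1 ≤ a → a ≤ k → 2 * w a ∈ φ.range) (hg : ∀ j < k, twist σ w g j ∈ φ.range)
    (c : ℕ → A) (hc : c 0 = 1) :
    twist σ w (star g fun i => φ (c i)) k - twist σ w g k ∈ φ.range := by
  have hg2 := two_pow_mul_mem H hw0 (fun a h1 h2 => hw a h1 h2.le) hg
  rw [twist_star]
  rcases k with _ | k
  · simp [twist, hc]
  rw [Finset.Nat.sum_antidiagonal_succ, hc, map_one]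
  simp only [one_pow, mul_one, add_sub_cancel_left]
  refine sum_mem fun p hp => ?_
  rw [HasAntidiagonal.mem_antidiagonal] at hp
  have h := twist_smul_sub_mem H (w := w) (f := g) (k := p.2)
    (fun a h1 h2 => hw a h1 (by lia)) (fun j hj => hg2 j (by lia)) (c (p.1 + 1))
  have h2 := add_mem h (mul_mem (pow_mem (RingHom.mem_range_self φ (c (p.1 + 1))) (2 ^ p.2)) (hg p.2 (by lia)))
  rwa [sub_add_cancel] at h2

theorem twist_mem_of_star (H : FrobeniusLift φ σA σ) {w g : ℕ → B} {k : ℕ} (hw0 : w 0 = 1)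
    (hw : ∀ a, 1 ≤ a → a < k → 2 * w a ∈ φ.range) (c : ℕ → A) (hc : c 0 = 1)
    (hf : ∀ j < k, twist σ w (star g fun i => φ (c i)) j ∈ φ.range) :
    ∀ j < k, twist σ w g j ∈ φ.range := by
  intro j
  induction j using Nat.strong_induction_on with
  | _ j ih =>
  intro hj
  have h := twist_star_sub_mem H hw0 (fun a h1 h2 => hw a h1 (by lia))
    (fun i hi => ih i hi (by lia)) c hc
  have h2 := sub_mem (hf j hj) h
  rwa [sub_sub_cancel] at h2

/-- The weights for which `twist σ (weight σ f) f` vanishes in positive degrees. -/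
def weight (σ : B →+* B) (f : ℕ → B) : ℕ → B
  | 0 => 1
  | k + 1 => - ∑ i : Fin (k + 1), weight σ f i * (σ ^ (i : ℕ)) (f (k + 1 - i))

theorem weight_zero (σ : B →+* B) (f : ℕ → B) : weight σ f 0 = 1 := by rw [weight]

theorem weight_succ (σ : B →+* B) (f : ℕ → B) (k : ℕ) :
    weight σ f (k + 1) =
      - ∑ p ∈ antidiagonal k, weight σ f p.1 * (σ ^ p.1) (f (p.2 + 1)) := by
  rw [weight, Fin.sum_univ_eq_sum_range (fun i => weight σ f i * (σ ^ i) (f (k + 1 - i))),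
    Finset.Nat.sum_antidiagonal_eq_sum_range_succ_mk]
  congr 1
  refine Finset.sum_congr rfl fun i hi => ?_
  rw [Finset.mem_range] at hi
  rw [show k - i + 1 = k + 1 - i by lia]

theorem twist_weight_succ (σ : B →+* B) (f : ℕ → B) (hf : f 0 = 1) (k : ℕ) :
    twist σ (weight σ f) f (k + 1) = 0 := by
  rw [twist, Finset.Nat.sum_antidiagonal_succ', weight_succ, hf, map_one]
  ring

theorem twist_weight_mem (f : ℕ → B) (hf : f 0 = 1) (k : ℕ) :
    twist σ (weight σ f) f k ∈ φ.range := by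
  rcases k with _ | k
  · simp [twist, weight_zero, hf]
  · rw [twist_weight_succ _ _ hf]
    exact zero_mem _

/-- A chain of integral strict isomorphisms from `f 0` to its negative in positive degrees
forces the weights of `f 0` to be half-integral. -/
theorem two_mul_weight_mem (H : FrobeniusLift φ σA σ) (f : ℕ → ℕ → B) (c : ℕ → ℕ → A) (N : ℕ)
    (hf0 : ∀ s, f s 0 = 1) (hc : ∀ s, c s 0 = 1)
    (hf : ∀ s k, f s k = star (f (s + 1)) (fun i => φ (c s i)) k)
    (hN : ∀ k, f N (k + 1) = - f 0 (k + 1)) (k : ℕ) :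
    2 * weight σ (f 0) (k + 1) ∈ φ.range := by
  induction k using Nat.strong_induction_on with
  | _ k ih =>
  have hfs : ∀ s, f s = star (f (s + 1)) (fun i => φ (c s i)) := fun s => funext (hf s)
  set w : ℕ → B := fun a => if a < k + 1 then weight σ (f 0) a else 0 with hwdef
  have hw0 : w 0 = 1 := by simp [hwdef, weight_zero]
  have hw : ∀ a, 1 ≤ a → a ≤ k + 1 → 2 * w a ∈ φ.range := by
    intro a ha hak
    simp only [hwdef]
    split_ifs with h
    · obtain ⟨b, rfl⟩ := Nat.exists_eq_add_of_le' ha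
      exact ih b (by lia)
    · simp
  have hsmall : ∀ s, ∀ j < k + 1, twist σ w (f s) j ∈ φ.range := by
    intro s
    induction s with
    | zero =>
      intro j hj
      have e : twist σ w (f 0) j = twist σ (weight σ (f 0)) (f 0) j := by
        refine Finset.sum_congr rfl fun p hp => ?_
        rw [HasAntidiagonal.mem_antidiagonal] at hp
        simp only [hwdef]
        rw [if_pos (by lia)]
      rw [e]
      exact twist_weight_mem _ (hf0 0) j
    | succ s ihs =>
      rw [hfs s] at ihs
      exact twist_mem_of_star H hw0 (fun a h1 h2 => hw a h1 h2.le) (c s) (hc s) ihs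
  have hdiff : ∀ s, twist σ w (f 0) (k + 1) - twist σ w (f s) (k + 1) ∈ φ.range := by
    intro s
    induction s with
    | zero => simp
    | succ s ihs =>
      have h := twist_star_sub_mem H hw0 hw (hsmall (s + 1)) (c s) (hc s)
      rw [← hfs s] at h
      have h2 := add_mem ihs h
      rwa [sub_add_sub_cancel] at h2
  have hwk : w (k + 1) = 0 := by simp [hwdef]
  have hfirst : twist σ w (f 0) (k + 1) = - weight σ (f 0) (k + 1) := by
    rw [twist, Finset.Nat.sum_antidiagonal_succ', weight_succ, neg_neg, hwk, zero_mul, zero_add]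
    refine Finset.sum_congr rfl fun p hp => ?_
    rw [HasAntidiagonal.mem_antidiagonal] at hp
    simp only [hwdef]
    rw [if_pos (by lia)]
  have hlast : twist σ w (f N) (k + 1) = - twist σ w (f 0) (k + 1) := by
    rw [twist, twist, Finset.Nat.sum_antidiagonal_succ', Finset.Nat.sum_antidiagonal_succ', hwk]
    simp [hN]
  have h := hdiff N
  rw [hlast, hfirst] at h
  have h2 := neg_mem h
  convert h2 using 1
  ring

theorem star_congr {f c c' : ℕ → B} {k : ℕ} (h : ∀ i ≤ k, c i = c' i) :
    star f c k = star f c' k := by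
  refine Finset.sum_congr rfl fun p hp => ?_
  rw [HasAntidiagonal.mem_antidiagonal] at hp
  rw [h p.1 (by lia)]

theorem star_eq_add {f c : ℕ → B} (hf : f 0 = 1) (k : ℕ) :
    star f c (k + 1) = c (k + 1) + ∑ p ∈ antidiagonal k, f (p.2 + 1) * c p.1 ^ 2 ^ (p.2 + 1) := by
  rw [star, Finset.Nat.sum_antidiagonal_succ']
  simp [hf]

theorem star_left_injective {f c c' : ℕ → B} (hf : f 0 = 1) (h : ∀ k, star f c k = star f c' k) :
    c = c' := by
  funext k
  induction k using Nat.strong_induction_on with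
  | _ k ih =>
  have hk := h k
  rcases k with _ | k
  · simpa [star, hf] using hk
  rw [star_eq_add hf, star_eq_add hf] at hk
  have e : ∑ p ∈ antidiagonal k, f (p.2 + 1) * c p.1 ^ 2 ^ (p.2 + 1) =
      ∑ p ∈ antidiagonal k, f (p.2 + 1) * c' p.1 ^ 2 ^ (p.2 + 1) := by
    refine Finset.sum_congr rfl fun p hp => ?_
    rw [HasAntidiagonal.mem_antidiagonal] at hp
    rw [ih p.1 (by lia)]
  rwa [e, add_left_inj] at hk

/-- The solution `c` of `star g c = f`. -/
def starSolve (g f : ℕ → B) : ℕ → B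
  | 0 => f 0
  | k + 1 => f (k + 1) - ∑ i : Fin (k + 1), g (k + 1 - i) * starSolve g f i ^ 2 ^ (k + 1 - i)

theorem star_starSolve {g : ℕ → B} (hg : g 0 = 1) (f : ℕ → B) (k : ℕ) :
    star g (starSolve g f) k = f k := by
  rcases k with _ | k
  · simp [star, hg, starSolve]
  rw [star_eq_add hg, starSolve, Fin.sum_univ_eq_sum_range
      (fun i => g (k + 1 - i) * starSolve g f i ^ 2 ^ (k + 1 - i)),
    Finset.Nat.sum_antidiagonal_eq_sum_range_succ_mk, sub_add_eq_add_sub, add_sub_assoc,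
    sub_eq_zero_of_eq, add_zero]
  refine Finset.sum_congr rfl fun i hi => ?_
  rw [Finset.mem_range] at hi
  rw [show k - i + 1 = k + 1 - i by lia]

theorem exists_star_eq (H : FrobeniusLift φ σA σ) {w g f : ℕ → B} (hg0 : g 0 = 1) (hw0 : w 0 = 1)
    (hw : ∀ a, 2 * w (a + 1) ∈ φ.range) (hf : ∀ k, twist σ w f k ∈ φ.range)
    (hg : ∀ k, twist σ w g k ∈ φ.range) :
    ∃ c : ℕ → A, ∀ k, star g (fun i => φ (c i)) k = f k := by
  have hw' : ∀ a, 1 ≤ a → 2 * w a ∈ φ.range := by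
    intro a h1
    obtain ⟨b, rfl⟩ := Nat.exists_eq_add_of_le' h1
    exact hw b
  have hg2 : ∀ j, 2 ^ j * g j ∈ φ.range := fun j =>
    two_pow_mul_mem H (K := j + 1) hw0 (fun a h1 _ => hw' a h1) (fun j _ => hg j) j (by lia)
  have hterm : ∀ (x : A) (m : ℕ), twist σ w (fun j => g j * φ x ^ 2 ^ j) m ∈ φ.range := by
    intro x m
    have h := twist_smul_sub_mem H (w := w) (f := g) (k := m) (fun a h1 _ => hw' a h1)
      (fun j _ => hg2 j) x
    have h2 := add_mem h (mul_mem (pow_mem (RingHom.mem_range_self φ x) (2 ^ m)) (hg m))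
    rwa [sub_add_cancel] at h2
  have key : ∀ k, starSolve g f k ∈ φ.range := by
    intro k
    induction k using Nat.strong_induction_on with
    | _ k ih =>
    have h := hf k
    have e : twist σ w f k = twist σ w (star g (starSolve g f)) k := by
      rw [show star g (starSolve g f) = f from funext (star_starSolve hg0 f)]
    rw [e, twist_star] at h
    rcases k with _ | k
    · simpa [twist, hw0, hg0] using h
    rw [Finset.Nat.sum_antidiagonal_succ'] at h
    have h1 : ∑ p ∈ antidiagonal k,
        twist σ w (fun j => g j * starSolve g f p.1 ^ 2 ^ j) (p.2 + 1) ∈ φ.range := by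
      refine sum_mem fun p hp => ?_
      rw [HasAntidiagonal.mem_antidiagonal] at hp
      obtain ⟨x, hx⟩ := ih p.1 (by lia)
      simp only [← hx]
      exact hterm x _
    have h2 := sub_mem h h1
    rw [add_sub_cancel_right] at h2
    simpa [twist, hw0, hg0] using h2
  choose c hc using key
  refine ⟨c, fun k => ?_⟩
  rw [← star_starSolve hg0 f k]
  exact star_congr fun i _ => hc i

end FunctionalEquation

/-! ### Arithmetic of `R_n` and `R_n ⊗ ℚ` -/

section Arithmetic

theorem Z2.not_two_dvd_one : ¬ (2 : Z2) ∣ 1 := by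
  rintro ⟨⟨d, hd⟩, h⟩
  have h1 : (1 : ℚ) = 2 * d := congrArg Subtype.val h
  have h2 : d = 1 / 2 := by linarith
  have h3 : Odd d.den := hd
  rw [h2] at h3
  norm_num at h3

theorem Z2.two_dvd_or (c : Z2) : (2 : Z2) ∣ c ∨ (2 : Z2) ∣ c - 1 := by
  have hc : Odd (c : ℚ).den := c.2
  obtain ⟨e, he⟩ := hc
  have h : c * (2 * (e : Z2) + 1) = ((c : ℚ).num : Z2) := by
    ext
    have := Rat.mul_den_eq_num (c : ℚ)
    rw [he] at this
    push_cast at this ⊢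
    exact this
  rcases Int.even_or_odd' (c : ℚ).num with ⟨m, hm | hm⟩
  · left
    refine ⟨m - c * e, ?_⟩
    rw [hm] at h
    push_cast at h
    linear_combination h
  · right
    refine ⟨m - c * e, ?_⟩
    rw [hm] at h
    push_cast at h
    linear_combination h

theorem Z2.prime_two : Prime (2 : Z2) := by
  refine ⟨fun h => Z2.not_two_dvd_one ?_, fun h => Z2.not_two_dvd_one h.dvd, fun a b h => ?_⟩
  · have h1 : (2 : ℚ) = 0 := by simpa using congrArg Subtype.val h
    norm_num at h1
  · by_contra! hab
    have h1 := (Z2.two_dvd_or a).resolve_left hab.1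
    have h2 := (Z2.two_dvd_or b).resolve_left hab.2
    refine Z2.not_two_dvd_one ?_
    have h3 := (dvd_sub h ((h1.mul_right b).add h2))
    convert h3 using 1
    ring

theorem Z2.two_dvd_sub_sq (c : Z2) : (2 : Z2) ∣ c - c ^ 2 := by
  rw [show c - c ^ 2 = -(c * (c - 1)) by ring, dvd_neg]
  rcases Z2.two_dvd_or c with h | h
  · exact h.mul_right _
  · exact h.mul_left _

variable (n : ℕ)

theorem prime_two : Prime (2 : R n) := by
  have h := (MvPolynomial.prime_C_iff (ℕ × Fin (2 ^ (n - 1)))).2 Z2.prime_two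
  rwa [map_ofNat] at h

theorem algebraMap_eq_map : algebraMap (R n) (RQ n) = MvPolynomial.map (algebraMap Z2 ℚ) := rfl

theorem algebraMap_injective : Function.Injective (algebraMap (R n) (RQ n)) :=
  MvPolynomial.map_injective _ Subtype.val_injective

theorem gamma_apply (K : Type) [CommRing K] (x : Poly n K) :
    gamma n K x = gammaHom n K x := rfl

theorem gamma_algebraMap (x : R n) :
    gamma n ℚ (algebraMap (R n) (RQ n) x) = algebraMap (R n) (RQ n) (gamma n Z2 x) := by
  simp only [gamma_apply, algebraMap_eq_map]
  induction x using MvPolynomial.induction_on with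
  | C a =>
    rw [MvPolynomial.map_C, ← MvPolynomial.algebraMap_eq, ← MvPolynomial.algebraMap_eq,
      AlgHom.commutes, AlgHom.commutes, MvPolynomial.algebraMap_eq, MvPolynomial.algebraMap_eq,
      MvPolynomial.map_C]
  | add p q hp hq => simp only [map_add, hp, hq]
  | mul_X p i hp =>
    simp only [map_mul, hp, MvPolynomial.map_X]
    congr 1
    simp only [gammaHom, MvPolynomial.aeval_X]
    split_ifs <;> simp

theorem gamma_pow_algebraMap (s : ℕ) (x : R n) :
    (gamma n ℚ ^ s) (algebraMap (R n) (RQ n) x) =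
      algebraMap (R n) (RQ n) ((gamma n Z2 ^ s) x) := by
  induction s with
  | zero => rfl
  | succ s ih => rw [pow_succ', pow_succ', AlgEquiv.mul_apply, AlgEquiv.mul_apply, ih,
      gamma_algebraMap]

theorem gamma_pow_gen (K : Type) [CommRing K] (m i a : ℕ) :
    (gamma n K ^ m) (gen n K i a) = gen n K i (a + m) := by
  induction m with
  | zero => rfl
  | succ m ih => rw [pow_succ', AlgEquiv.mul_apply, ih, gamma_apply, gammaHom_gen, add_assoc]

theorem gamma_pow_order (K : Type) [CommRing K] : gamma n K ^ (2 * 2 ^ (n - 1)) = 1 := by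
  have h : ∀ m (x : Poly n K), (gamma n K ^ m) x = (gammaHom n K ^ m) x := by
    intro m x
    induction m with
    | zero => rfl
    | succ m ih => rw [pow_succ', AlgEquiv.mul_apply, ih, pow_succ', AlgHom.mul_apply]; rfl
  ext x
  rw [h, gammaHom_pow_order]
  rfl

theorem t_succ (i : ℕ) : t n (i + 1) = gen n Z2 i 0 := by
  simp [t, gen]

theorem gamma_pow_half_t (i : ℕ) : (gamma n Z2 ^ 2 ^ (n - 1)) (t n (i + 1)) = - t n (i + 1) := by
  rw [t_succ, gamma_pow_gen]
  simp [gen]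

/-- The lift of the Frobenius on `R_n` and `R_n ⊗ ℚ` squaring the polynomial generators. -/
theorem frobeniusLift : FrobeniusLift (algebraMap (R n) (RQ n))
    (MvPolynomial.expand 2 : R n →ₐ[Z2] R n).toRingHom
    (MvPolynomial.expand 2 : RQ n →ₐ[ℚ] RQ n).toRingHom where
  comm a := by
    simp [MvPolynomial.map_expand]
  frob a := by
    simp only [AlgHom.toRingHom_eq_coe, RingHom.coe_coe]
    induction a using MvPolynomial.induction_on with
    | C c =>
      rw [MvPolynomial.expand_C, ← map_pow, ← map_sub, ← map_ofNat MvPolynomial.C 2]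
      exact map_dvd _ (Z2.two_dvd_sub_sq c)
    | add p q hp hq =>
      have h := (hp.add hq).sub (Dvd.intro (p * q) rfl)
      convert h using 1
      rw [map_add]
      ring
    | mul_X p i hp =>
      have h := hp.mul_right (MvPolynomial.X i ^ 2)
      convert h using 1
      rw [map_mul, MvPolynomial.expand_X]
      ring

end Arithmetic

/-! ### The logarithm coefficients -/

section LogCoefficients

variable (n : ℕ)

/-- The recursion satisfied by the logarithm of the canonical formal group law. -/
structure IsLogSystem {n : ℕ} (ℓ : ℕ → RQ n) : Prop where
  zero : ℓ 0 = 1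
  strict : ∀ k, ℓ k = star (fun i => gamma n ℚ (ℓ i)) (fun i => algebraMap (R n) (RQ n) (t n i)) k
  neg : ∀ k, (gamma n ℚ ^ 2 ^ (n - 1)) (ℓ (k + 1)) = - ℓ (k + 1)

/-- The difference of the `k + 1`-st logarithm coefficient and its image under `γ`. -/
noncomputable def logDiff {n : ℕ} (ℓ : ℕ → RQ n) (k : ℕ) : RQ n :=
  ∑ p ∈ antidiagonal k,
    gamma n ℚ (ℓ p.2) * algebraMap (R n) (RQ n) (t n (p.1 + 1)) ^ 2 ^ p.2

theorem star_gamma_succ {n : ℕ} (ℓ : ℕ → RQ n) (k : ℕ) :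
    star (fun i => gamma n ℚ (ℓ i)) (fun i => algebraMap (R n) (RQ n) (t n i)) (k + 1) =
      gamma n ℚ (ℓ (k + 1)) + logDiff ℓ k := by
  rw [star, Finset.Nat.sum_antidiagonal_succ, logDiff]
  simp [t]

/-- The coefficients of the logarithm of the canonical formal group law. -/
noncomputable def logCoeff : ℕ → RQ n
  | 0 => 1
  | k + 1 => MvPolynomial.C (1 / 2) * ∑ s ∈ range (2 ^ (n - 1)), (gamma n ℚ ^ s)
      (∑ i : Fin (k + 1), gamma n ℚ (logCoeff i) *
        algebraMap (R n) (RQ n) (t n (k - i + 1)) ^ 2 ^ (i : ℕ))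

theorem logCoeff_zero : logCoeff n 0 = 1 := by rw [logCoeff]

theorem logCoeff_succ (k : ℕ) : logCoeff n (k + 1) =
    MvPolynomial.C (1 / 2) * ∑ s ∈ range (2 ^ (n - 1)), (gamma n ℚ ^ s)
      (logDiff (logCoeff n) k) := by
  rw [logCoeff, Fin.sum_univ_eq_sum_range (fun i => gamma n ℚ (logCoeff n i) *
        algebraMap (R n) (RQ n) (t n (k - i + 1)) ^ 2 ^ (i : ℕ)), logDiff,
    ← Finset.Nat.sum_antidiagonal_swap, Finset.Nat.sum_antidiagonal_eq_sum_range_succ_mk]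
  rfl

theorem gamma_pow_half_logDiff {ℓ : ℕ → RQ n} {k : ℕ} (h0 : ℓ 0 = 1)
    (hneg : ∀ j < k, (gamma n ℚ ^ 2 ^ (n - 1)) (ℓ (j + 1)) = - ℓ (j + 1)) :
    (gamma n ℚ ^ 2 ^ (n - 1)) (logDiff ℓ k) = - logDiff ℓ k := by
  rw [logDiff, map_sum, ← Finset.sum_neg_distrib]
  refine Finset.sum_congr rfl fun p hp => ?_
  rw [HasAntidiagonal.mem_antidiagonal] at hp
  obtain ⟨a, b⟩ := p
  simp only at hp ⊢
  rw [map_mul, map_pow, gamma_pow_algebraMap, gamma_pow_half_t, map_neg]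
  rcases b with _ | b
  · simp [h0]
  · rw [← AlgEquiv.mul_apply, ← pow_succ, pow_succ', AlgEquiv.mul_apply, hneg b (by lia), map_neg,
      Even.neg_pow (by simp [Nat.even_pow]), neg_mul]

theorem half_mul_two : (MvPolynomial.C (1 / 2) : RQ n) * 2 = 1 := by
  rw [← map_ofNat MvPolynomial.C 2, ← map_mul]
  norm_num

theorem logCoeff_neg (k : ℕ) :
    (gamma n ℚ ^ 2 ^ (n - 1)) (logCoeff n (k + 1)) = - logCoeff n (k + 1) := by
  induction k using Nat.strong_induction_on with
  | _ k ih =>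
  have h := gamma_pow_half_logDiff n (logCoeff_zero n) ih
  rw [logCoeff_succ, map_mul, map_sum, ← mul_neg, ← Finset.sum_neg_distrib]
  congr 1
  · rw [← MvPolynomial.algebraMap_eq, AlgEquiv.commutes]
  · refine Finset.sum_congr rfl fun s _ => ?_
    rw [← AlgEquiv.mul_apply, ← pow_add, add_comm, pow_add, AlgEquiv.mul_apply, h, map_neg]

theorem logCoeff_sub_gamma (k : ℕ) :
    logCoeff n (k + 1) - gamma n ℚ (logCoeff n (k + 1)) = logDiff (logCoeff n) k := by
  have h := gamma_pow_half_logDiff n (logCoeff_zero n) (fun j _ => logCoeff_neg n j) (k := k)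
  rw [logCoeff_succ, map_mul, map_sum, ← MvPolynomial.algebraMap_eq, AlgEquiv.commutes, ← mul_sub,
    ← Finset.sum_sub_distrib]
  simp only [← AlgEquiv.mul_apply, ← pow_succ']
  rw [Finset.sum_range_sub' (fun s => (gamma n ℚ ^ s) (logDiff (logCoeff n) k)), h, pow_zero,
    AlgEquiv.one_apply, sub_neg_eq_add, ← two_mul, ← mul_assoc, MvPolynomial.algebraMap_eq,
    half_mul_two, one_mul]

theorem isLogSystem_logCoeff : IsLogSystem (logCoeff n) where
  zero := logCoeff_zero n
  strict k := by
    rcases k with _ | k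
    · simp [star, logCoeff_zero, t]
    · rw [star_gamma_succ, ← logCoeff_sub_gamma, add_sub_cancel]
  neg := logCoeff_neg n

variable {n}

theorem IsLogSystem.sub_gamma {ℓ : ℕ → RQ n} (h : IsLogSystem ℓ) (k : ℕ) :
    ℓ (k + 1) - gamma n ℚ (ℓ (k + 1)) = logDiff ℓ k := by
  rw [sub_eq_iff_eq_add', ← star_gamma_succ, ← h.strict]

theorem IsLogSystem.two_mul {ℓ : ℕ → RQ n} (h : IsLogSystem ℓ) (k : ℕ) :
    2 * ℓ (k + 1) = ∑ s ∈ range (2 ^ (n - 1)), (gamma n ℚ ^ s) (logDiff ℓ k) := by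
  simp only [← h.sub_gamma, map_sub, ← AlgEquiv.mul_apply, ← pow_succ]
  rw [Finset.sum_range_sub' (fun s => (gamma n ℚ ^ s) (ℓ (k + 1))), h.neg, pow_zero,
    AlgEquiv.one_apply]
  ring

theorem IsLogSystem.eq_logCoeff {ℓ : ℕ → RQ n} (h : IsLogSystem ℓ) : ℓ = logCoeff n := by
  funext k
  induction k using Nat.strong_induction_on with
  | _ k ih =>
  rcases k with _ | k
  · rw [h.zero, logCoeff_zero]
  have e : logDiff ℓ k = logDiff (logCoeff n) k := by
    refine Finset.sum_congr rfl fun p hp => ?_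
    rw [HasAntidiagonal.mem_antidiagonal] at hp
    rw [ih p.2 (by lia)]
  rw [logCoeff_succ, ← e, ← h.two_mul, ← mul_assoc, half_mul_two, one_mul]

theorem IsLogSystem.strict_pow {ℓ : ℕ → RQ n} (h : IsLogSystem ℓ) (s k : ℕ) :
    (gamma n ℚ ^ s) (ℓ k) = star (fun i => (gamma n ℚ ^ (s + 1)) (ℓ i))
      (fun i => algebraMap (R n) (RQ n) ((gamma n Z2 ^ s) (t n i))) k := by
  conv_lhs => rw [h.strict k]
  have e := map_star ((gamma n ℚ ^ s : RQ n ≃ₐ[ℚ] RQ n) : RQ n →+* RQ n)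
    (fun i => gamma n ℚ (ℓ i)) (fun i => algebraMap (R n) (RQ n) (t n i)) k
  simp only [RingHom.coe_coe, gamma_pow_algebraMap, ← AlgEquiv.mul_apply, ← pow_succ] at e
  exact e

variable (n)

/-- The Frobenius lift on `R_n ⊗ ℚ`. -/
noncomputable abbrev frob : RQ n →+* RQ n :=
  (MvPolynomial.expand 2 : RQ n →ₐ[ℚ] RQ n).toRingHom

/-- The weights of the functional equation of the canonical logarithm. -/
noncomputable def logWeight : ℕ → RQ n := weight (frob n) (logCoeff n)

theorem logWeight_zero : logWeight n 0 = 1 := weight_zero _ _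

theorem two_mul_logWeight_mem (k : ℕ) :
    2 * logWeight n (k + 1) ∈ (algebraMap (R n) (RQ n)).range :=
  two_mul_weight_mem (frobeniusLift n) (fun s k => (gamma n ℚ ^ s) (logCoeff n k))
    (fun s k => (gamma n Z2 ^ s) (t n k)) (2 ^ (n - 1))
    (fun s => by rw [logCoeff_zero, map_one]) (fun s => by simp [t])
    (fun s k => (isLogSystem_logCoeff n).strict_pow s k) (fun k => logCoeff_neg n k) k

theorem twist_logCoeff_mem (k : ℕ) :
    twist (frob n) (logWeight n) (logCoeff n) k ∈ (algebraMap (R n) (RQ n)).range :=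
  twist_weight_mem _ (logCoeff_zero n) k

theorem exists_araki : ∃ v : ℕ → R n, ∀ k,
    star (logCoeff n) (fun i => algebraMap (R n) (RQ n) (v i)) k = 2 * logCoeff n k := by
  refine exists_star_eq (frobeniusLift n) (logCoeff_zero n) (logWeight_zero n)
    (two_mul_logWeight_mem n) (fun k => ?_) (twist_logCoeff_mem n)
  have e : twist (frob n) (logWeight n) (fun k => 2 * logCoeff n k) k =
      2 * twist (frob n) (logWeight n) (logCoeff n) k := by
    simp only [twist, Finset.mul_sum, map_mul, map_ofNat]
    refine Finset.sum_congr rfl fun p _ => ?_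
    ring
  exact e ▸ mul_mem (ofNat_mem _ 2) (twist_logCoeff_mem n k)

end LogCoefficients

/-! ### The ideals `I_k` -/

section Ideals

variable {n : ℕ}

theorem two_mem_idealI (v : ℕ → R n) (k : ℕ) : 2 ∈ idealI v k :=
  Ideal.subset_span (Set.mem_insert _ _)

theorem mem_idealI {v : ℕ → R n} (h0 : v 0 = 2) {i k : ℕ} (h : i < k) : v i ∈ idealI v k := by
  rcases i with _ | i
  · rw [h0]
    exact two_mem_idealI v k
  · exact Ideal.subset_span (Set.mem_insert_of_mem _ ⟨i + 1, ⟨by lia, h⟩, rfl⟩)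

theorem idealI_mono (v : ℕ → R n) {k m : ℕ} (h : k ≤ m) : idealI v k ≤ idealI v m :=
  Ideal.span_mono (Set.insert_subset_insert (Set.image_mono (Set.Ico_subset_Ico_right h)))

theorem two_mem_moduleL (ℓ : ℕ → RQ n) (g : RQ n ≃ₐ[ℚ] RQ n) (k : ℕ) : 2 ∈ moduleL ℓ g k :=
  Submodule.subset_span (Set.mem_insert _ _)

theorem mem_moduleL (ℓ : ℕ → RQ n) (g : RQ n ≃ₐ[ℚ] RQ n) {i k : ℕ} (h : i + 1 < k) :
    g (ℓ (i + 1)) ∈ moduleL ℓ g k :=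
  Submodule.subset_span (Set.mem_insert_of_mem _ ⟨i + 1, ⟨by lia, h⟩, rfl⟩)

theorem mul_algebraMap_mem {M : Submodule (R n) (RQ n)} {y : RQ n} (hy : y ∈ M) (x : R n) :
    y * algebraMap (R n) (RQ n) x ∈ M := by
  rw [mul_comm, ← Algebra.smul_def]
  exact M.smul_mem x hy

theorem moduleL_succ (ℓ : ℕ → RQ n) (g : RQ n ≃ₐ[ℚ] RQ n) (k : ℕ) :
    moduleL ℓ g (k + 2) = Submodule.span (R n) {g (ℓ (k + 1))} ⊔ moduleL ℓ g (k + 1) := by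
  have h : Set.Ico 1 (k + 2) = insert (k + 1) (Set.Ico 1 (k + 1)) := by
    ext i
    simp only [Set.mem_Ico, Set.mem_insert_iff]
    lia
  rw [moduleL, h, Set.image_insert_eq, Set.insert_comm, Submodule.span_insert, moduleL]

theorem symm_mem_moduleL {ℓ : ℕ → RQ n} {g : RQ n ≃ₐ[ℚ] RQ n} {G : R n ≃ₐ[Z2] R n}
    (hg : ∀ x, g (algebraMap (R n) (RQ n) x) = algebraMap (R n) (RQ n) (G x)) {k : ℕ} {z : RQ n}
    (hz : z ∈ moduleL ℓ g k) : g.symm z ∈ moduleL ℓ 1 k := by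
  induction hz using Submodule.span_induction with
  | mem x hx =>
    rcases hx with rfl | ⟨i, hi, rfl⟩
    · rw [map_ofNat]
      exact two_mem_moduleL _ _ _
    · simp only [AlgEquiv.symm_apply_apply]
      exact Submodule.subset_span (Set.mem_insert_of_mem _ ⟨i, hi, rfl⟩)
  | zero => simp
  | add x y _ _ hx hy => rw [map_add]; exact add_mem hx hy
  | smul a x _ hx =>
    have e : g.symm (algebraMap (R n) (RQ n) a) = algebraMap (R n) (RQ n) (G.symm a) := by
      rw [AlgEquiv.symm_apply_eq, hg, AlgEquiv.apply_symm_apply]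
    rw [Algebra.smul_def, map_mul, e, ← Algebra.smul_def]
    exact Submodule.smul_mem _ _ hx

theorem apply_mem_moduleL {ℓ : ℕ → RQ n} {g : RQ n ≃ₐ[ℚ] RQ n} {G : R n ≃ₐ[Z2] R n}
    (hg : ∀ x, g (algebraMap (R n) (RQ n) x) = algebraMap (R n) (RQ n) (G x)) {k : ℕ} {z : RQ n}
    (hz : z ∈ moduleL ℓ 1 k) : g z ∈ moduleL ℓ g k := by
  induction hz using Submodule.span_induction with
  | mem x hx =>
    rcases hx with rfl | ⟨i, hi, rfl⟩
    · rw [map_ofNat]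
      exact two_mem_moduleL _ _ _
    · exact Submodule.subset_span (Set.mem_insert_of_mem _ ⟨i, hi, rfl⟩)
  | zero => simp
  | add x y _ _ hx hy => rw [map_add]; exact add_mem hx hy
  | smul a x _ hx =>
    rw [Algebra.smul_def, map_mul, hg, ← Algebra.smul_def]
    exact Submodule.smul_mem _ _ hx

/-- `v` is the sequence of Araki elements for the logarithm coefficients `ℓ`. -/
def IsArakiSystem (ℓ : ℕ → RQ n) (v : ℕ → R n) : Prop :=
  ∀ k, star ℓ (fun i => algebraMap (R n) (RQ n) (v i)) k = 2 * ℓ k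

variable {ℓ : ℕ → RQ n} {v : ℕ → R n}

theorem IsArakiSystem.zero (hv : IsArakiSystem ℓ v) (h0 : ℓ 0 = 1) : v 0 = 2 := by
  apply algebraMap_injective
  have h := hv 0
  simp only [star] at h
  simpa [h0] using h

theorem IsArakiSystem.two_mul_eq (hv : IsArakiSystem ℓ v) (h0 : ℓ 0 = 1) (k : ℕ) :
    2 * ℓ (k + 1) = algebraMap (R n) (RQ n) (v (k + 1)) +
      ∑ p ∈ antidiagonal k, ℓ (p.2 + 1) * algebraMap (R n) (RQ n) (v p.1) ^ 2 ^ (p.2 + 1) := by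
  rw [← hv, star_eq_add h0]

theorem IsArakiSystem.mem_moduleL (hv : IsArakiSystem ℓ v) (h0 : ℓ 0 = 1) {i k : ℕ} (h : i < k) :
    algebraMap (R n) (RQ n) (v i) ∈ moduleL ℓ 1 k := by
  rcases i with _ | i
  · rw [hv.zero h0, map_ofNat]
    exact two_mem_moduleL _ _ _
  have e := hv.two_mul_eq h0 i
  rw [← sub_eq_iff_eq_add] at e
  rw [← e]
  refine sub_mem ?_ (sum_mem fun p hp => ?_)
  · have h2 := mul_algebraMap_mem (EquivariantBP.mem_moduleL ℓ 1 h) 2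
    rwa [map_ofNat, mul_comm] at h2
  · rw [HasAntidiagonal.mem_antidiagonal] at hp
    rw [← map_pow]
    exact mul_algebraMap_mem (EquivariantBP.mem_moduleL ℓ 1 (by lia)) _

theorem IsArakiSystem.idealI_le (hv : IsArakiSystem ℓ v) (h0 : ℓ 0 = 1) (k : ℕ) :
    idealI v k ≤ (moduleL ℓ 1 k).comap (Algebra.linearMap (R n) (RQ n)) := by
  refine Submodule.span_le.2 ?_
  rintro x (rfl | ⟨i, hi, rfl⟩)
  · change algebraMap (R n) (RQ n) 2 ∈ moduleL ℓ 1 k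
    rw [map_ofNat]
    exact two_mem_moduleL _ _ _
  · exact hv.mem_moduleL h0 hi.2

theorem IsLogSystem.two_pow_mul_mem (hℓ : IsLogSystem ℓ) (k : ℕ) :
    2 ^ k * ℓ k ∈ (algebraMap (R n) (RQ n)).range := by
  rw [hℓ.eq_logCoeff]
  refine EquivariantBP.two_pow_mul_mem (frobeniusLift n) (K := k + 1) (logWeight_zero n)
    (fun a h1 _ => ?_) (fun j _ => twist_logCoeff_mem n j) k (by lia)
  obtain ⟨b, rfl⟩ := Nat.exists_eq_add_of_le' h1
  exact two_mul_logWeight_mem n b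

theorem exists_two_pow_mul_eq (hℓ : IsLogSystem ℓ) (hv : IsArakiSystem ℓ v) (k : ℕ) :
    ∃ c, 2 ^ k * ℓ k = algebraMap (R n) (RQ n) (v 1 ^ (2 ^ k - 1) + 2 * c) := by
  choose X hX using fun k => hℓ.two_pow_mul_mem k
  have hv0 := hv.zero hℓ.zero
  suffices h : ∃ c, X k = v 1 ^ (2 ^ k - 1) + 2 * c by
    obtain ⟨c, hc⟩ := h
    exact ⟨c, by rw [← hc, hX]⟩
  induction k with
  | zero =>
    refine ⟨0, algebraMap_injective n ?_⟩
    rw [hX, hℓ.zero]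
    simp
  | succ m ih =>
    obtain ⟨c, hc⟩ := ih
    have key : ∀ p ∈ antidiagonal (m + 1), ∃ y,
        2 ^ m * (ℓ p.2 * algebraMap (R n) (RQ n) (v p.1) ^ 2 ^ p.2) = algebraMap (R n) (RQ n)
          ((if p = (1, m) then X m * v 1 ^ 2 ^ m else 0) + 2 * y) := by
      rintro ⟨i, j⟩ hp
      rw [HasAntidiagonal.mem_antidiagonal] at hp
      simp only at hp ⊢
      rcases i with _ | _ | i
      · obtain rfl : j = m + 1 := by lia
        rw [if_neg (by simp), hv0]
        refine ⟨X (m + 1) * 2 ^ (2 ^ (m + 1) - 2), ?_⟩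
        simp only [zero_add, map_mul, map_pow, map_ofNat, hX]
        obtain ⟨e, he⟩ := Nat.exists_eq_add_of_le' (show 2 ≤ 2 ^ (m + 1) by
          rw [pow_succ]; have := Nat.one_le_two_pow (n := m); lia)
        rw [he, Nat.add_sub_cancel]
        ring
      · obtain rfl : j = m := by lia
        refine ⟨0, ?_⟩
        rw [if_pos rfl]
        simp only [zero_add, mul_zero, add_zero, map_mul, map_pow, hX]
        ring
      · obtain ⟨d, rfl⟩ : ∃ d, m = j + d + 1 := ⟨i, by lia⟩
        rw [if_neg (by simp)]
        refine ⟨X j * 2 ^ d * v (i + 1 + 1) ^ 2 ^ j, ?_⟩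
        simp only [zero_add, map_mul, map_pow, map_ofNat, hX]
        ring
    choose! y hy using key
    have h1 : X (m + 1) = X m * v 1 ^ 2 ^ m + 2 * ∑ p ∈ antidiagonal (m + 1), y p := by
      apply algebraMap_injective
      rw [hX, pow_succ, mul_assoc, ← hv, star, Finset.mul_sum, Finset.sum_congr rfl hy,
        ← map_sum, Finset.sum_add_distrib, Finset.mul_sum, Finset.sum_ite_eq',
        if_pos (by simp [add_comm])]
    refine ⟨c * v 1 ^ 2 ^ m + ∑ p ∈ antidiagonal (m + 1), y p, ?_⟩
    have h2 : 2 ^ (m + 1) - 1 = (2 ^ m - 1) + 2 ^ m := by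
      have := Nat.one_le_two_pow (n := m)
      rw [pow_succ]; lia
    rw [h1, hc, h2, pow_add]
    ring

theorem araki_one (hℓ : IsLogSystem ℓ) (hv : IsArakiSystem ℓ v) :
    v 1 = - ∑ s ∈ range (2 ^ (n - 1)), gen n Z2 0 s := by
  apply algebraMap_injective
  have h1 := hv.two_mul_eq hℓ.zero 0
  have h2 := hℓ.two_mul 0
  have h3 : ∀ s, (gamma n ℚ ^ s) (logDiff ℓ 0) = algebraMap (R n) (RQ n) (gen n Z2 0 s) := by
    intro s
    simp only [logDiff, Finset.Nat.antidiagonal_zero, sum_singleton, hℓ.zero, map_one, one_mul,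
      pow_zero, pow_one, zero_add, gamma_pow_algebraMap, t_succ, gamma_pow_gen]
  simp only [h3] at h2
  simp only [Finset.Nat.antidiagonal_zero, sum_singleton, hv.zero hℓ.zero, map_ofNat, zero_add] at h1
  rw [map_neg, map_sum, ← h2]
  linear_combination (-1 : RQ n) * h1

theorem not_two_dvd_araki_one (hℓ : IsLogSystem ℓ) (hv : IsArakiSystem ℓ v) : ¬ 2 ∣ v 1 := by
  intro h
  let f : R n →ₐ[Z2] Z2 := MvPolynomial.aeval fun p => if p.1 = 0 ∧ p.2.val = 0 then 1 else 0
  have hN : 0 < 2 ^ (n - 1) := by positivity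
  have h1 := map_dvd f h
  have h2 : ∀ s ∈ range (2 ^ (n - 1)), f (gen n Z2 0 s) = if s = 0 then 1 else 0 := by
    intro s hs
    rw [Finset.mem_range] at hs
    simp [f, gen, Nat.div_eq_of_lt hs, Nat.mod_eq_of_lt hs]
  rw [araki_one hℓ hv, map_neg, map_sum, Finset.sum_congr rfl h2, Finset.sum_ite_eq',
    if_pos (by simp), dvd_neg, map_ofNat] at h1
  exact Z2.not_two_dvd_one h1

theorem two_pow_mul_mem_of_mem_moduleL (hℓ : IsLogSystem ℓ) {k : ℕ} {y : RQ n}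
    (hy : y ∈ moduleL ℓ 1 (k + 1)) : 2 ^ k * y ∈ (algebraMap (R n) (RQ n)).range := by
  induction hy using Submodule.span_induction with
  | mem x hx =>
    rcases hx with rfl | ⟨i, hi, rfl⟩
    · exact mul_mem (pow_mem (ofNat_mem _ 2) _) (ofNat_mem _ 2)
    · obtain ⟨d, rfl⟩ := Nat.exists_eq_add_of_le' (Nat.lt_succ_iff.1 hi.2)
      rw [pow_add, mul_assoc]
      exact mul_mem (pow_mem (ofNat_mem _ 2) _) (hℓ.two_pow_mul_mem i)
  | zero => simp
  | add x y _ _ hx hy => rw [mul_add]; exact add_mem hx hy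
  | smul a x _ hx =>
    rw [Algebra.smul_def, mul_left_comm]
    exact mul_mem ⟨a, rfl⟩ hx

theorem mem_idealI_of_mem_moduleL (hℓ : IsLogSystem ℓ) (hv : IsArakiSystem ℓ v) (k : ℕ) :
    ∀ x : R n, algebraMap (R n) (RQ n) x ∈ moduleL ℓ 1 (k + 1) → x ∈ idealI v (k + 1) := by
  have hv0 := hv.zero hℓ.zero
  induction k with
  | zero =>
    intro x hx
    simp only [moduleL, zero_add, Set.Ico_self, Set.image_empty, insert_empty_eq,
      Submodule.mem_span_singleton] at hx
    obtain ⟨a, ha⟩ := hx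
    have e : x = a * 2 := by
      apply algebraMap_injective
      rw [← ha, Algebra.smul_def, map_mul, map_ofNat]
    rw [e]
    exact Ideal.mul_mem_left _ _ (two_mem_idealI _ _)
  | succ m ih =>
    intro x hx
    rw [moduleL_succ, Submodule.mem_sup] at hx
    obtain ⟨z, hz, y, hy, hxy⟩ := hx
    obtain ⟨b, rfl⟩ := Submodule.mem_span_singleton.1 hz
    rw [Algebra.smul_def, AlgEquiv.one_apply] at hxy
    have hb : 2 ∣ b := by
      obtain ⟨c, hc⟩ := exists_two_pow_mul_eq hℓ hv (m + 1)
      obtain ⟨w, hw⟩ := two_pow_mul_mem_of_mem_moduleL hℓ hy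
      have e : b * v 1 ^ (2 ^ (m + 1) - 1) = 2 * (2 ^ m * x - b * c - w) := by
        apply algebraMap_injective
        rw [map_add] at hc
        simp only [map_mul, map_pow, map_sub, map_ofNat] at hc ⊢
        rw [hw]
        linear_combination (-2 ^ (m + 1) : RQ n) * hxy - algebraMap (R n) (RQ n) b * hc +
          2 ^ (m + 1) * hxy + 2 ^ (m + 1) * hxy
      rcases (prime_two n).dvd_or_dvd (Dvd.intro _ e.symm) with h | h
      · exact h
      · exact absurd ((prime_two n).dvd_of_dvd_pow h) (not_two_dvd_araki_one hℓ hv)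
    obtain ⟨c, rfl⟩ := hb
    set e : ℕ := 2 ^ (m + 1) - 1 with he
    have hpow : (2 : ℕ) ^ (m + 1) = e + 1 := by
      have := Nat.one_le_two_pow (n := m + 1)
      lia
    have he1 : e ≠ 0 := by
      have : 1 < 2 ^ (m + 1) := Nat.one_lt_two_pow (by lia)
      lia
    have hY : 2 * ℓ (m + 1) - 2 ^ e * (2 * ℓ (m + 1)) - algebraMap (R n) (RQ n) (v (m + 1)) ∈
        moduleL ℓ 1 (m + 1) := by
      have h := hv.two_mul_eq hℓ.zero m
      have hs : ∑ p ∈ antidiagonal m,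
          ℓ (p.2 + 1) * algebraMap (R n) (RQ n) (v p.1) ^ 2 ^ (p.2 + 1) -
            2 ^ e * (2 * ℓ (m + 1)) ∈ moduleL ℓ 1 (m + 1) := by
        rcases m with _ | m
        · simp only [Finset.Nat.antidiagonal_zero, sum_singleton, hv0, map_ofNat, hpow]
          convert zero_mem (moduleL ℓ 1 (0 + 1)) using 1
          ring
        rw [Finset.Nat.sum_antidiagonal_succ, hv0, map_ofNat, hpow]
        have h2 : ∀ S : RQ n, ℓ (m + 1 + 1) * 2 ^ (e + 1) + S - 2 ^ e * (2 * ℓ (m + 1 + 1)) = S :=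
          fun S => by ring
        rw [h2]
        refine sum_mem fun p hp => ?_
        rw [HasAntidiagonal.mem_antidiagonal] at hp
        rw [← map_pow]
        exact mul_algebraMap_mem (mem_moduleL ℓ 1 (by lia)) _
      convert hs using 1
      linear_combination h
    have h1 : algebraMap (R n) (RQ n) (x - 2 ^ e * x - c * v (m + 1)) ∈ moduleL ℓ 1 (m + 1) := by
      have h2 := add_mem (mul_algebraMap_mem hy (1 - 2 ^ e)) (mul_algebraMap_mem hY c)
      convert h2 using 1
      simp only [map_mul, map_pow, map_sub, map_ofNat, map_one, ← hxy]
      ring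
    have h3 := idealI_mono v (Nat.le_succ (m + 1)) (ih _ h1)
    have h4 : 2 ^ e * x + c * v (m + 1) ∈ idealI v (m + 1 + 1) :=
      add_mem (Ideal.mul_mem_right _ _ (Ideal.pow_mem_of_mem _ (two_mem_idealI _ _) _
        (Nat.pos_of_ne_zero he1))) (Ideal.mul_mem_left _ _ (mem_idealI hv0 (by lia)))
    have h5 := add_mem h3 h4
    rwa [sub_sub, sub_add_cancel] at h5

theorem star_gamma_araki (hℓ : IsLogSystem ℓ) (hv : IsArakiSystem ℓ v) (k : ℕ) :
    ∑ p ∈ antidiagonal k, ∑ q ∈ antidiagonal p.1, gamma n ℚ (ℓ p.2) *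
      (algebraMap (R n) (RQ n) (t n q.2 * v q.1 ^ 2 ^ q.2) ^ 2 ^ p.2 -
        algebraMap (R n) (RQ n) (gamma n Z2 (v q.1) * t n q.2 ^ 2 ^ q.1) ^ 2 ^ p.2) = 0 := by
  have h1 : 2 * ℓ k = ∑ p ∈ antidiagonal k, ∑ q ∈ antidiagonal p.2,
      gamma n ℚ (ℓ q.2) * algebraMap (R n) (RQ n) (t n q.1 * v p.1 ^ 2 ^ q.1) ^ 2 ^ q.2 := by
    rw [← hv, star]
    refine Finset.sum_congr rfl fun p _ => ?_
    rw [hℓ.strict p.2, star, Finset.sum_mul]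
    refine Finset.sum_congr rfl fun q hq => ?_
    rw [HasAntidiagonal.mem_antidiagonal] at hq
    rw [← hq, pow_add, pow_mul, map_mul, map_pow, mul_pow, mul_assoc]
  have h2 : 2 * ℓ k = ∑ p ∈ antidiagonal k, ∑ q ∈ antidiagonal p.2,
      gamma n ℚ (ℓ q.2) *
        algebraMap (R n) (RQ n) (gamma n Z2 (v q.1) * t n p.1 ^ 2 ^ q.1) ^ 2 ^ q.2 := by
    rw [hℓ.strict k, star, Finset.mul_sum]
    refine Finset.sum_congr rfl fun p _ => ?_
    have e := map_star ((gamma n ℚ : RQ n ≃ₐ[ℚ] RQ n) : RQ n →+* RQ n) ℓ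
      (fun i => algebraMap (R n) (RQ n) (v i)) p.2
    rw [hv, map_mul, map_ofNat] at e
    simp only [RingHom.coe_coe, gamma_algebraMap] at e
    rw [← mul_assoc, e, star, Finset.sum_mul]
    refine Finset.sum_congr rfl fun q hq => ?_
    rw [HasAntidiagonal.mem_antidiagonal] at hq
    rw [← hq, pow_add, pow_mul, map_mul, map_pow, mul_pow, mul_assoc]
  rw [sum_antidiagonal_left_comm k (fun i j l => gamma n ℚ (ℓ l) *
        algebraMap (R n) (RQ n) (gamma n Z2 (v j) * t n i ^ 2 ^ j) ^ 2 ^ l)] at h2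
  simp only [mul_sub, Finset.sum_sub_distrib]
  rw [sum_antidiagonal_assoc k (fun i j l => gamma n ℚ (ℓ l) *
        algebraMap (R n) (RQ n) (t n j * v i ^ 2 ^ j) ^ 2 ^ l), ← h1,
    sum_antidiagonal_assoc k (fun i j l => gamma n ℚ (ℓ l) *
        algebraMap (R n) (RQ n) (gamma n Z2 (v i) * t n j ^ 2 ^ i) ^ 2 ^ l), ← h2, sub_self]

theorem mem_of_gamma_mem {k : ℕ} (hk : ∀ x ∈ idealI v k, gamma n Z2 x ∈ idealI v k) (x : R n)
    (hx : gamma n Z2 x ∈ idealI v k) : x ∈ idealI v k := by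
  have h : ∀ m : ℕ, (gamma n Z2 ^ m) (gamma n Z2 x) ∈ idealI v k := by
    intro m
    induction m with
    | zero => exact hx
    | succ m ih =>
      rw [pow_succ', AlgEquiv.mul_apply]
      exact hk _ ih
  have h2 := h (2 * 2 ^ (n - 1) - 1)
  have hN : 0 < 2 ^ (n - 1) := by positivity
  rwa [← AlgEquiv.mul_apply, ← pow_succ, Nat.sub_add_cancel (by lia), gamma_pow_order,
    AlgEquiv.one_apply] at h2

theorem mem_idealI_of_mem_gamma_moduleL (hℓ : IsLogSystem ℓ) (hv : IsArakiSystem ℓ v) {k : ℕ}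
    (hk : ∀ x ∈ idealI v (k + 1), gamma n Z2 x ∈ idealI v (k + 1)) (s : ℕ) (x : R n)
    (hx : algebraMap (R n) (RQ n) x ∈ moduleL ℓ (gamma n ℚ ^ s) (k + 1)) :
    x ∈ idealI v (k + 1) := by
  have h := symm_mem_moduleL (G := gamma n Z2 ^ s) (gamma_pow_algebraMap n s) hx
  have e : (gamma n ℚ ^ s).symm (algebraMap (R n) (RQ n) x) =
      algebraMap (R n) (RQ n) ((gamma n Z2 ^ s).symm x) := by
    rw [AlgEquiv.symm_apply_eq, gamma_pow_algebraMap, AlgEquiv.apply_symm_apply]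
  rw [e] at h
  have h2 := mem_idealI_of_mem_moduleL hℓ hv k _ h
  have h3 : ∀ m : ℕ, ∀ y ∈ idealI v (k + 1), (gamma n Z2 ^ m) y ∈ idealI v (k + 1) := by
    intro m
    induction m with
    | zero => exact fun y hy => hy
    | succ m ih =>
      intro y hy
      rw [pow_succ', AlgEquiv.mul_apply]
      exact hk _ (ih y hy)
  have h4 := h3 s _ h2
  rwa [AlgEquiv.apply_symm_apply] at h4

theorem sub_gamma_mem (hℓ : IsLogSystem ℓ) (hv : IsArakiSystem ℓ v) {k : ℕ}
    (hk : ∀ x ∈ idealI v (k + 1), gamma n Z2 x ∈ idealI v (k + 1)) :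
    v (k + 1) - gamma n Z2 (v (k + 1)) ∈ idealI v (k + 1) := by
  have hv0 := hv.zero hℓ.zero
  set D : R n := ∑ q ∈ antidiagonal (k + 1),
    (t n q.2 * v q.1 ^ 2 ^ q.2 - gamma n Z2 (v q.1) * t n q.2 ^ 2 ^ q.1) with hD
  have hDmem : D ∈ idealI v (k + 1) := by
    refine mem_idealI_of_mem_gamma_moduleL hℓ hv hk 1 D ?_
    have h := star_gamma_araki hℓ hv (k + 1)
    rw [Finset.Nat.sum_antidiagonal_succ', hℓ.zero] at h
    simp only [map_one, one_mul, pow_zero, pow_one, ← map_sub, ← map_sum, ← hD] at h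
    rw [eq_neg_of_add_eq_zero_left h, pow_one]
    refine neg_mem (sum_mem fun p hp => sum_mem fun q hq => ?_)
    rw [HasAntidiagonal.mem_antidiagonal] at hp hq
    obtain ⟨a, b⟩ := p
    obtain ⟨i, j⟩ := q
    simp only at hp hq ⊢
    rcases Nat.eq_zero_or_pos a with rfl | ha
    · obtain rfl : i = 0 := by lia
      obtain rfl : j = 0 := by lia
      convert zero_mem (moduleL ℓ (gamma n ℚ) (k + 1)) using 1
      simp only [hv0, t, map_ofNat, pow_zero, pow_one, one_mul, mul_one, sub_self,
        mul_zero]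
    · rw [← map_pow, ← map_pow, ← map_sub]
      exact mul_algebraMap_mem (mem_moduleL ℓ (gamma n ℚ) (by lia)) _
  rw [hD, Finset.Nat.sum_antidiagonal_succ'] at hDmem
  have hrest : ∑ p ∈ antidiagonal k, (t n (p.2 + 1) * v p.1 ^ 2 ^ (p.2 + 1) -
      gamma n Z2 (v p.1) * t n (p.2 + 1) ^ 2 ^ p.1) ∈ idealI v (k + 1) := by
    refine sum_mem fun p hp => ?_
    rw [HasAntidiagonal.mem_antidiagonal] at hp
    have h := mem_idealI hv0 (show p.1 < k + 1 by lia)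
    exact sub_mem (Ideal.mul_mem_left _ _ (Ideal.pow_mem_of_mem _ h _ (by positivity)))
      (Ideal.mul_mem_right _ _ (hk _ h))
  have h := sub_mem hDmem hrest
  rw [add_sub_cancel_right] at h
  simpa [t] using h

theorem gamma_mem_idealI (hℓ : IsLogSystem ℓ) (hv : IsArakiSystem ℓ v) (k : ℕ) :
    ∀ x ∈ idealI v (k + 1), gamma n Z2 x ∈ idealI v (k + 1) := by
  induction k with
  | zero =>
    intro x hx
    simp only [idealI, zero_add, Set.Ico_self, Set.image_empty, insert_empty_eq,
      Ideal.mem_span_singleton] at hx ⊢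
    have h := map_dvd (gamma n Z2) hx
    rwa [map_ofNat] at h
  | succ k ih =>
    have h := sub_gamma_mem hℓ hv ih
    have hle := idealI_mono v (Nat.le_succ (k + 1))
    have h1 : idealI v (k + 1 + 1) ≤ (idealI v (k + 1 + 1)).comap (gamma n Z2) := by
      refine Submodule.span_le.2 ?_
      rintro x (rfl | ⟨i, hi, rfl⟩)
      · change gamma n Z2 2 ∈ idealI v (k + 1 + 1)
        rw [map_ofNat]
        exact two_mem_idealI _ _
      · change gamma n Z2 (v i) ∈ idealI v (k + 1 + 1)
        rcases Nat.lt_succ_iff_lt_or_eq.1 hi.2 with h2 | rfl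
        · exact hle (ih _ (mem_idealI (hv.zero hℓ.zero) h2))
        · have h3 := sub_mem (mem_idealI (hv.zero hℓ.zero) (Nat.lt_succ_self (k + 1))) (hle h)
          rwa [sub_sub_cancel] at h3
    exact fun x hx => h1 hx

theorem apply_mem_idealI_iff (hℓ : IsLogSystem ℓ) (hv : IsArakiSystem ℓ v) (k : ℕ)
    {g : R n ≃ₐ[Z2] R n} (hg : g ∈ Subgroup.zpowers (gamma n Z2)) (x : R n) :
    g x ∈ idealI v (k + 1) ↔ x ∈ idealI v (k + 1) := by
  have hk := gamma_mem_idealI hℓ hv k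
  rw [Subgroup.zpowers_eq_closure] at hg
  induction hg using Subgroup.closure_induction generalizing x with
  | mem y hy =>
    rw [Set.mem_singleton_iff.1 hy]
    exact ⟨mem_of_gamma_mem hk x, hk x⟩
  | one => rfl
  | mul y z _ _ hy hz => exact (hy (z x)).trans (hz x)
  | inv y _ hy =>
    have h := hy (y⁻¹ x)
    rw [← AlgEquiv.mul_apply, mul_inv_cancel, AlgEquiv.one_apply] at h
    exact h.symm

theorem map_idealI_of_mem_zpowers (hℓ : IsLogSystem ℓ) (hv : IsArakiSystem ℓ v) (k : ℕ)
    {g : R n ≃ₐ[Z2] R n} (hg : g ∈ Subgroup.zpowers (gamma n Z2)) :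
    (idealI v (k + 1)).map g = idealI v (k + 1) := by
  refine le_antisymm (Ideal.map_le_iff_le_comap.2 fun x hx =>
    (apply_mem_idealI_iff hℓ hv k hg x).2 hx) fun x hx => ?_
  have h2 := Ideal.mem_map_of_mem g ((apply_mem_idealI_iff hℓ hv k (inv_mem hg) x).2 hx)
  rwa [← AlgEquiv.mul_apply, mul_inv_cancel, AlgEquiv.one_apply] at h2

theorem comap_moduleL (hℓ : IsLogSystem ℓ) (hv : IsArakiSystem ℓ v) (k s : ℕ) :
    (moduleL ℓ (gamma n ℚ ^ s) (k + 1)).comap (Algebra.linearMap (R n) (RQ n)) =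
      idealI v (k + 1) := by
  have hG : gamma n Z2 ^ s ∈ Subgroup.zpowers (gamma n Z2) :=
    Subgroup.npow_mem_zpowers _ _
  have hmem : ∀ x : R n, (gamma n Z2 ^ s).symm x ∈ idealI v (k + 1) ↔ x ∈ idealI v (k + 1) :=
    fun x => by rw [← apply_mem_idealI_iff hℓ hv k hG, AlgEquiv.apply_symm_apply]
  have hsymm : ∀ x, (gamma n ℚ ^ s).symm (algebraMap (R n) (RQ n) x) =
      algebraMap (R n) (RQ n) ((gamma n Z2 ^ s).symm x) := fun x => by
    rw [AlgEquiv.symm_apply_eq, gamma_pow_algebraMap, AlgEquiv.apply_symm_apply]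
  refine le_antisymm (fun x hx => ?_) fun x hx => ?_
  · have h := symm_mem_moduleL (G := gamma n Z2 ^ s) (gamma_pow_algebraMap n s) hx
    rw [Algebra.linearMap_apply, hsymm] at h
    exact (hmem x).1 (mem_idealI_of_mem_moduleL hℓ hv k _ h)
  · have h := apply_mem_moduleL (G := gamma n Z2 ^ s) (gamma_pow_algebraMap n s)
      (hv.idealI_le hℓ.zero (k + 1) ((hmem x).2 hx))
    rw [Algebra.linearMap_apply, gamma_pow_algebraMap, AlgEquiv.apply_symm_apply] at h
    exact h

end Ideals

/-! ### Formal group laws and their logarithms -/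

section Logarithms

variable {A B : Type*} [CommRing A] [CommRing B] {τ υ : Type*}

theorem hasSubst_pair {f g : MvPowerSeries τ A} (hf : MvPowerSeries.constantCoeff f = 0)
    (hg : MvPowerSeries.constantCoeff g = 0) : MvPowerSeries.HasSubst ![f, g] :=
  MvPowerSeries.hasSubst_of_constantCoeff_zero fun s => by fin_cases s <;> simpa

theorem constantCoeff_fAdd (F : FormalGroup A) {f g : MvPowerSeries τ A}
    (hf : MvPowerSeries.constantCoeff f = 0) (hg : MvPowerSeries.constantCoeff g = 0) :
    MvPowerSeries.constantCoeff (fAdd F f g) = 0 :=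
  MvPowerSeries.constantCoeff_subst_eq_zero (hasSubst_pair hf hg)
    (fun s => by fin_cases s <;> simpa) F.zero_constantCoeff

theorem map_fAdd (φ : A →+* B) (F : FormalGroup A) {f g : MvPowerSeries τ A}
    (hf : MvPowerSeries.constantCoeff f = 0) (hg : MvPowerSeries.constantCoeff g = 0) :
    MvPowerSeries.map φ (fAdd F f g) =
      fAdd (F.map φ) (MvPowerSeries.map φ f) (MvPowerSeries.map φ g) := by
  rw [fAdd, MvPowerSeries.map_subst (hasSubst_pair hf hg), fAdd]
  congr 1
  funext i
  fin_cases i <;> rfl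

theorem subst_fAdd (F : FormalGroup A) {f g : MvPowerSeries τ A} {a : τ → MvPowerSeries υ A}
    (hf : MvPowerSeries.constantCoeff f = 0) (hg : MvPowerSeries.constantCoeff g = 0)
    (ha : MvPowerSeries.HasSubst a) : MvPowerSeries.subst a (fAdd F f g) =
      fAdd F (MvPowerSeries.subst a f) (MvPowerSeries.subst a g) := by
  rw [fAdd, MvPowerSeries.subst_comp_subst_apply (hasSubst_pair hf hg) ha, fAdd]
  congr 1
  funext i
  fin_cases i <;> rfl

theorem fAdd_add {f g : MvPowerSeries τ A} (hf : MvPowerSeries.constantCoeff f = 0)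
    (hg : MvPowerSeries.constantCoeff g = 0) : fAdd FormalGroup.𝔾ₐ f g = f + g := by
  have h := hasSubst_pair hf hg
  simp [fAdd, MvPowerSeries.subst_add h, MvPowerSeries.subst_X h]

theorem mvSubst_subst {f : MvPowerSeries τ A} {a : τ → MvPowerSeries υ A}
    (hf : MvPowerSeries.constantCoeff f = 0) (ha : MvPowerSeries.HasSubst a) (P : PowerSeries A) :
    MvPowerSeries.subst a (PowerSeries.subst f P) =
      PowerSeries.subst (MvPowerSeries.subst a f) P :=
  MvPowerSeries.subst_comp_subst_apply (PowerSeries.HasSubst.of_constantCoeff_zero hf).const ha P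

theorem constantCoeff_of_coeff_zero {P : PowerSeries A} (h : PowerSeries.coeff 0 P = 0) :
    MvPowerSeries.constantCoeff P = 0 := by
  rw [PowerSeries.coeff_zero_eq_constantCoeff_apply] at h
  exact h

theorem IsStrictHom.constantCoeff {F G : FormalGroup A} {ψ : PowerSeries A}
    (h : IsStrictHom F G ψ) : MvPowerSeries.constantCoeff ψ = 0 :=
  constantCoeff_of_coeff_zero h.coeff_zero

theorem constantCoeff_subst_zero {f : MvPowerSeries τ A} {P : PowerSeries A}
    (hf : MvPowerSeries.constantCoeff f = 0) (hP : MvPowerSeries.constantCoeff P = 0) :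
    MvPowerSeries.constantCoeff (PowerSeries.subst f P) = 0 :=
  PowerSeries.constantCoeff_subst_eq_zero hf P hP

theorem subst_subst {f : MvPowerSeries τ A} {P Q : PowerSeries A}
    (hf : MvPowerSeries.constantCoeff f = 0) (hP : MvPowerSeries.constantCoeff P = 0) :
    PowerSeries.subst f (PowerSeries.subst P Q) = PowerSeries.subst (PowerSeries.subst f P) Q :=
  PowerSeries.subst_comp_subst_apply (PowerSeries.HasSubst.of_constantCoeff_zero hP)
    (PowerSeries.HasSubst.of_constantCoeff_zero hf) Q

theorem IsStrictHom.subst_fAdd {F G : FormalGroup A} {ψ : PowerSeries A} (h : IsStrictHom F G ψ)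
    {f g : MvPowerSeries τ A} (hf : MvPowerSeries.constantCoeff f = 0)
    (hg : MvPowerSeries.constantCoeff g = 0) : PowerSeries.subst (fAdd F f g) ψ =
      fAdd G (PowerSeries.subst f ψ) (PowerSeries.subst g ψ) := by
  have hfg := hasSubst_pair hf hg
  have h1 := congrArg (MvPowerSeries.subst ![f, g]) h.hom
  have hX : ∀ i : Fin 2, MvPowerSeries.constantCoeff (MvPowerSeries.X i : MvPowerSeries _ A) = 0 :=
    fun i => MvPowerSeries.constantCoeff_X i
  rw [mvSubst_subst F.zero_constantCoeff hfg,
    EquivariantBP.subst_fAdd G (constantCoeff_subst_zero (hX 0) h.constantCoeff)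
      (constantCoeff_subst_zero (hX 1) h.constantCoeff) hfg, mvSubst_subst (hX 0) hfg,
    mvSubst_subst (hX 1) hfg, MvPowerSeries.subst_X hfg, MvPowerSeries.subst_X hfg] at h1
  exact h1

/-- A compositional inverse of a series of the form `x + ⋯`. -/
theorem exists_inverse {L : PowerSeries A} (h0 : MvPowerSeries.constantCoeff L = 0)
    (h1 : PowerSeries.coeff 1 L = 1) : ∃ M : PowerSeries A,
      MvPowerSeries.constantCoeff M = 0 ∧ PowerSeries.subst L M = PowerSeries.X ∧
      PowerSeries.subst M L = PowerSeries.X := by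
  have hu : IsUnit (PowerSeries.coeff 1 L) := by rw [h1]; exact isUnit_one
  exact ⟨L.substInvOfIsUnit hu, L.constantCoeff_substInvOfIsUnit hu,
    L.subst_substInvOfIsUnit_left h0 hu, L.subst_substInvOfIsUnit_right h0 hu⟩

theorem subst_injective {L : PowerSeries A} (h0 : MvPowerSeries.constantCoeff L = 0)
    (h1 : PowerSeries.coeff 1 L = 1) {f g : MvPowerSeries τ A}
    (hf : MvPowerSeries.constantCoeff f = 0) (hg : MvPowerSeries.constantCoeff g = 0)
    (h : PowerSeries.subst f L = PowerSeries.subst g L) : f = g := by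
  obtain ⟨M, hM0, hM, -⟩ := exists_inverse h0 h1
  have h2 := congrArg (fun x => PowerSeries.subst x M) h
  simp only [← subst_subst hf h0, ← subst_subst hg h0, hM] at h2
  rwa [PowerSeries.subst_X (PowerSeries.HasSubst.of_constantCoeff_zero hf),
    PowerSeries.subst_X (PowerSeries.HasSubst.of_constantCoeff_zero hg)] at h2

theorem coeff_pow_congr {f g : MvPowerSeries τ A} {m : ℕ}
    (h : ∀ e : τ →₀ ℕ, e.degree < m → MvPowerSeries.coeff e f = MvPowerSeries.coeff e g) (d : ℕ)
    (e : τ →₀ ℕ) (he : e.degree < m) :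
    MvPowerSeries.coeff e (f ^ d) = MvPowerSeries.coeff e (g ^ d) := by
  classical
  induction d generalizing e with
  | zero => simp
  | succ d ih =>
    rw [pow_succ, pow_succ, MvPowerSeries.coeff_mul, MvPowerSeries.coeff_mul]
    refine Finset.sum_congr rfl fun p hp => ?_
    rw [HasAntidiagonal.mem_antidiagonal] at hp
    have h1 : p.1.degree + p.2.degree = e.degree := by rw [← hp, map_add]
    rw [ih p.1 (by lia), h p.2 (by lia)]

theorem coeff_subst_congr {f g : MvPowerSeries τ A} {m : ℕ}
    (hf : MvPowerSeries.constantCoeff f = 0) (hg : MvPowerSeries.constantCoeff g = 0)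
    (h : ∀ e : τ →₀ ℕ, e.degree < m → MvPowerSeries.coeff e f = MvPowerSeries.coeff e g)
    (P : PowerSeries A) (e : τ →₀ ℕ) (he : e.degree < m) :
    MvPowerSeries.coeff e (PowerSeries.subst f P) =
      MvPowerSeries.coeff e (PowerSeries.subst g P) := by
  rw [PowerSeries.coeff_subst (PowerSeries.HasSubst.of_constantCoeff_zero hf),
    PowerSeries.coeff_subst (PowerSeries.HasSubst.of_constantCoeff_zero hg)]
  exact finsum_congr fun d => by rw [coeff_pow_congr h d e he]

theorem coeff_eq_of_coeff_subst_eq {L : PowerSeries A} (h0 : MvPowerSeries.constantCoeff L = 0)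
    (h1 : PowerSeries.coeff 1 L = 1) {f g : MvPowerSeries τ A} {m : ℕ}
    (hf : MvPowerSeries.constantCoeff f = 0) (hg : MvPowerSeries.constantCoeff g = 0)
    (h : ∀ e : τ →₀ ℕ, e.degree < m → MvPowerSeries.coeff e (PowerSeries.subst f L) =
      MvPowerSeries.coeff e (PowerSeries.subst g L)) (e : τ →₀ ℕ) (he : e.degree < m) :
    MvPowerSeries.coeff e f = MvPowerSeries.coeff e g := by
  obtain ⟨M, hM0, hM, -⟩ := exists_inverse h0 h1
  have h2 := coeff_subst_congr (constantCoeff_subst_zero hf h0) (constantCoeff_subst_zero hg h0)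
    h M e he
  rwa [← subst_subst hf h0, ← subst_subst hg h0, hM,
    PowerSeries.subst_X (PowerSeries.HasSubst.of_constantCoeff_zero hf),
    PowerSeries.subst_X (PowerSeries.HasSubst.of_constantCoeff_zero hg)] at h2

theorem coeff_pow_eq_zero {f : MvPowerSeries τ A} (hf : MvPowerSeries.constantCoeff f = 0) {d : ℕ}
    {e : τ →₀ ℕ} (h : e.degree < d) : MvPowerSeries.coeff e (f ^ d) = 0 := by
  refine MvPowerSeries.coeff_of_lt_order (lt_of_lt_of_le ?_
    (MvPowerSeries.le_order_pow_of_constantCoeff_eq_zero d hf))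
  exact_mod_cast h

theorem coeff_twoSeries_two_pow (ℓ : ℕ → A) (k : ℕ) :
    PowerSeries.coeff (2 ^ k) (twoSeries ℓ) = ℓ k := by
  rw [twoSeries, PowerSeries.coeff_mk, Nat.log_pow (by norm_num), if_pos rfl]

theorem coeff_twoSeries_of_ne (ℓ : ℕ → A) {d : ℕ} (h : ∀ k, d ≠ 2 ^ k) :
    PowerSeries.coeff d (twoSeries ℓ) = 0 := by
  rw [twoSeries, PowerSeries.coeff_mk, if_neg (h _)]

theorem constantCoeff_twoSeries (ℓ : ℕ → A) :
    MvPowerSeries.constantCoeff (twoSeries ℓ) = 0 :=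
  constantCoeff_of_coeff_zero (coeff_twoSeries_of_ne ℓ fun k => (by positivity : 0 < 2 ^ k).ne)

theorem twoSeries_injective {ℓ ℓ' : ℕ → A} (h : twoSeries ℓ = twoSeries ℓ') : ℓ = ℓ' := by
  funext k
  rw [← coeff_twoSeries_two_pow ℓ, h, coeff_twoSeries_two_pow]

theorem map_twoSeries (φ : A →+* B) (ℓ : ℕ → A) :
    PowerSeries.map φ (twoSeries ℓ) = twoSeries fun k => φ (ℓ k) := by
  ext d
  simp only [twoSeries, PowerSeries.coeff_map, PowerSeries.coeff_mk]
  split_ifs <;> simp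

theorem coeff_subst_twoSeries (ℓ : ℕ → A) {f : MvPowerSeries τ A}
    (hf : MvPowerSeries.constantCoeff f = 0) {K : ℕ} {e : τ →₀ ℕ} (he : e.degree < 2 ^ K) :
    MvPowerSeries.coeff e (PowerSeries.subst f (twoSeries ℓ)) =
      ∑ b ∈ range K, ℓ b * MvPowerSeries.coeff e (f ^ 2 ^ b) := by
  classical
  rw [PowerSeries.coeff_subst (PowerSeries.HasSubst.of_constantCoeff_zero hf),
    finsum_eq_sum_of_support_subset (s := (range K).image fun b => 2 ^ b)]
  · rw [Finset.sum_image (fun a _ b _ h => Nat.pow_right_injective le_rfl h)]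
    simp [coeff_twoSeries_two_pow]
  · intro d hd
    rw [Function.mem_support] at hd
    by_cases h : ∃ k, d = 2 ^ k
    · obtain ⟨k, rfl⟩ := h
      simp only [coe_image, coe_range, Set.mem_image, Set.mem_Iio]
      refine ⟨k, ?_, rfl⟩
      by_contra! hk
      refine hd ?_
      rw [coeff_pow_eq_zero hf (lt_of_lt_of_le he (Nat.pow_le_pow_right (by norm_num) hk)),
        smul_zero]
    · push Not at h
      rw [coeff_twoSeries_of_ne ℓ h, zero_smul] at hd
      exact absurd rfl hd

end Logarithms

/-! ### Uniqueness of logarithms and formal sums -/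

section FormalSums

variable {A B : Type*} [CommRing A] [CommRing B] {τ υ : Type*}

theorem additiveGroup_map (φ : A →+* B) :
    (FormalGroup.𝔾ₐ : FormalGroup A).map φ = FormalGroup.𝔾ₐ := by
  ext1
  simp

theorem IsStrictHom.map (φ : A →+* B) {F G : FormalGroup A} {ψ : PowerSeries A}
    (h : IsStrictHom F G ψ) : IsStrictHom (F.map φ) (G.map φ) (PowerSeries.map φ ψ) where
  coeff_zero := by rw [PowerSeries.coeff_map, h.coeff_zero, map_zero]
  coeff_one := by rw [PowerSeries.coeff_map, h.coeff_one, map_one]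
  hom := by
    have hX : ∀ i : Fin 2, MvPowerSeries.constantCoeff (MvPowerSeries.X i : MvPowerSeries _ A) = 0 :=
      fun i => MvPowerSeries.constantCoeff_X i
    have h1 := congrArg (MvPowerSeries.map φ) h.hom
    rw [map_fAdd φ G (constantCoeff_subst_zero (hX 0) h.constantCoeff)
      (constantCoeff_subst_zero (hX 1) h.constantCoeff),
      PowerSeries.map_subst (PowerSeries.HasSubst.of_constantCoeff_zero F.zero_constantCoeff),
      PowerSeries.map_subst (PowerSeries.HasSubst.of_constantCoeff_zero (hX 0)),
      PowerSeries.map_subst (PowerSeries.HasSubst.of_constantCoeff_zero (hX 1)),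
      MvPowerSeries.map_X, MvPowerSeries.map_X] at h1
    exact h1

theorem IsStrictHom.subst_fAdd_add {F : FormalGroup A} {L : PowerSeries A}
    (h : IsStrictHom F FormalGroup.𝔾ₐ L) {f g : MvPowerSeries τ A}
    (hf : MvPowerSeries.constantCoeff f = 0) (hg : MvPowerSeries.constantCoeff g = 0) :
    PowerSeries.subst (fAdd F f g) L = PowerSeries.subst f L + PowerSeries.subst g L := by
  rw [h.subst_fAdd hf hg, fAdd_add (constantCoeff_subst_zero hf h.constantCoeff)
    (constantCoeff_subst_zero hg h.constantCoeff)]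

theorem IsStrictHom.subst_hom_add {F : FormalGroup A} {L : PowerSeries A}
    (h : IsStrictHom F FormalGroup.𝔾ₐ L) : PowerSeries.subst F.toPowerSeries L =
      PowerSeries.subst (MvPowerSeries.X 0 : MvPowerSeries (Fin 2) A) L +
        PowerSeries.subst (MvPowerSeries.X 1 : MvPowerSeries (Fin 2) A) L := by
  rw [h.hom, fAdd_add (constantCoeff_subst_zero (MvPowerSeries.constantCoeff_X _) h.constantCoeff)
    (constantCoeff_subst_zero (MvPowerSeries.constantCoeff_X _) h.constantCoeff)]

/-- The formal group law is determined by its logarithm. -/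
theorem formalGroup_eq_of_log {F G : FormalGroup A} {L : PowerSeries A}
    (hF : IsStrictHom F FormalGroup.𝔾ₐ L) (hG : IsStrictHom G FormalGroup.𝔾ₐ L) : F = G := by
  ext1
  refine subst_injective hF.constantCoeff hF.coeff_one F.zero_constantCoeff G.zero_constantCoeff ?_
  rw [hF.subst_hom_add, hG.subst_hom_add]

theorem eq_X_of_additive [Algebra ℚ A] {P : PowerSeries A} (h1 : PowerSeries.coeff 1 P = 1)
    (h0 : PowerSeries.coeff 0 P = 0)
    (h : PowerSeries.subst (MvPowerSeries.X 0 + MvPowerSeries.X 1 : MvPowerSeries (Fin 2) A) P =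
      PowerSeries.subst (MvPowerSeries.X 0 : MvPowerSeries (Fin 2) A) P +
        PowerSeries.subst (MvPowerSeries.X 1 : MvPowerSeries (Fin 2) A) P) :
    P = PowerSeries.X := by
  ext d
  rcases d with _ | _ | d
  · simpa using h0
  · simpa using h1
  · have h2 := congrArg (MvPowerSeries.coeff
      (Finsupp.single (0 : Fin 2) 1 + Finsupp.single 1 (d + 1))) h
    rw [PowerSeries.coeff_subst_X_zero_add_X_one, map_add, PowerSeries.coeff_subst_single,
      PowerSeries.coeff_subst_single, if_neg, if_neg] at h2
    · simp only [Finsupp.add_apply, Finsupp.single_eq_same, Finsupp.single_apply] at h2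
      norm_num at h2
      rw [add_comm 1 (d + 1)] at h2
      have h3 : IsUnit ((d : A) + 1 + 1) := by
        have h4 : IsUnit (((d + 1 + 1 : ℕ) : ℚ)) := by
          rw [isUnit_iff_ne_zero]; exact_mod_cast Nat.succ_ne_zero (d + 1)
        have h5 := h4.map (algebraMap ℚ A)
        simpa using h5
      have h6 : PowerSeries.coeff (d + 1 + 1) P = 0 := by
        refine h3.mul_right_eq_zero.1 ?_
        rw [← h2]
        ring
      rw [h6, PowerSeries.coeff_X, if_neg (by lia)]
    · intro h3
      have h4 := DFunLike.congr_fun h3 0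
      simp at h4
    · intro h3
      have h4 := DFunLike.congr_fun h3 1
      simp at h4

theorem coeff_one_subst {P Q : PowerSeries A} (hP : MvPowerSeries.constantCoeff P = 0) :
    PowerSeries.coeff 1 (PowerSeries.subst P Q) =
      PowerSeries.coeff 1 Q * PowerSeries.coeff 1 P := by
  rw [PowerSeries.coeff_subst' (PowerSeries.HasSubst.of_constantCoeff_zero hP),
    finsum_eq_single _ 1, pow_one, smul_eq_mul]
  intro d hd
  rcases d with _ | _ | d
  · simp [PowerSeries.coeff_one]
  · exact absurd rfl hd
  · have h : PowerSeries.coeff 1 (P ^ (d + 1 + 1)) = 0 := coeff_pow_eq_zero hP (by simp)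
    rw [h, smul_zero]

theorem log_unique [Algebra ℚ A] {F : FormalGroup A} {L L' : PowerSeries A}
    (hL : IsStrictHom F FormalGroup.𝔾ₐ L) (hL' : IsStrictHom F FormalGroup.𝔾ₐ L') : L = L' := by
  obtain ⟨M, hM0, hM, hM'⟩ := exists_inverse hL.constantCoeff hL.coeff_one
  have hX : ∀ i : Fin 2, MvPowerSeries.constantCoeff (MvPowerSeries.X i : MvPowerSeries _ A) = 0 :=
    fun i => MvPowerSeries.constantCoeff_X i
  have hXM : ∀ i : Fin 2, MvPowerSeries.constantCoeff
      (PowerSeries.subst (MvPowerSeries.X i : MvPowerSeries (Fin 2) A) M) = 0 :=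
    fun i => constantCoeff_subst_zero (hX i) hM0
  have hXML : ∀ i : Fin 2,
      PowerSeries.subst (PowerSeries.subst (MvPowerSeries.X i : MvPowerSeries (Fin 2) A) M) L =
        MvPowerSeries.X i := fun i => by
    rw [← subst_subst (hX i) hM0, hM',
      PowerSeries.subst_X (PowerSeries.HasSubst.of_constantCoeff_zero (hX i))]
  have key : PowerSeries.subst M L' = PowerSeries.X := by
    have hML' : MvPowerSeries.constantCoeff (PowerSeries.subst M L' : PowerSeries A) = 0 :=
      constantCoeff_subst_zero hM0 hL'.constantCoeff
    refine eq_X_of_additive ?_ ?_ ?_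
    · have h1 := congrArg (PowerSeries.coeff 1) hM
      rw [coeff_one_subst hL.constantCoeff, hL.coeff_one, mul_one, PowerSeries.coeff_one_X] at h1
      rw [coeff_one_subst hM0, hL'.coeff_one, h1, mul_one]
    · rw [PowerSeries.coeff_zero_eq_constantCoeff_apply]
      exact hML'
    · have h1 := hL.subst_fAdd_add (hXM 0) (hXM 1)
      have h2 := hL'.subst_fAdd_add (hXM 0) (hXM 1)
      have h3 : fAdd F (PowerSeries.subst (MvPowerSeries.X 0 : MvPowerSeries (Fin 2) A) M)
          (PowerSeries.subst (MvPowerSeries.X 1 : MvPowerSeries (Fin 2) A) M) =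
            PowerSeries.subst
              (MvPowerSeries.X 0 + MvPowerSeries.X 1 : MvPowerSeries (Fin 2) A) M := by
        rw [hXML, hXML] at h1
        have hc := constantCoeff_fAdd F (hXM 0) (hXM 1)
        rw [← h1, ← subst_subst hc hL.constantCoeff, hM,
          PowerSeries.subst_X (PowerSeries.HasSubst.of_constantCoeff_zero hc)]
      have hXX : MvPowerSeries.constantCoeff
          (MvPowerSeries.X 0 + MvPowerSeries.X 1 : MvPowerSeries (Fin 2) A) = 0 := by simp
      rw [h3] at h2
      rw [subst_subst hXX hM0, h2, subst_subst (hX 0) hM0, subst_subst (hX 1) hM0]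
  have h := subst_subst (f := L) (P := M) (Q := L') hL.constantCoeff hM0
  rw [key, hM, PowerSeries.subst_X (PowerSeries.HasSubst.of_constantCoeff_zero hL.constantCoeff)]
    at h
  rw [h]
  exact PowerSeries.X_subst L'

end FormalSums

section FormalSums

variable {A B : Type*} [CommRing A] [CommRing B] {τ υ : Type*}

theorem constantCoeff_monomial_two_pow (i : ℕ) (c : A) :
    MvPowerSeries.constantCoeff (PowerSeries.monomial (2 ^ i) c) = 0 :=
  constantCoeff_of_coeff_zero (by
    rw [PowerSeries.coeff_monomial, if_neg (by positivity : 0 < 2 ^ i).ne])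

theorem constantCoeff_formalPartialSum (F : FormalGroup A) (c : ℕ → A) (m : ℕ) :
    MvPowerSeries.constantCoeff (formalPartialSum F c m) = 0 := by
  induction m with
  | zero => rw [formalPartialSum]; exact map_zero _
  | succ m ih =>
    rw [formalPartialSum]
    exact constantCoeff_fAdd F ih (constantCoeff_monomial_two_pow m (c m))

theorem constantCoeff_formalSum (F : FormalGroup A) (c : ℕ → A) :
    MvPowerSeries.constantCoeff (formalSum F c) = 0 := by
  refine constantCoeff_of_coeff_zero ?_
  rw [formalSum, PowerSeries.coeff_mk, PowerSeries.coeff_zero_eq_constantCoeff_apply]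
  exact constantCoeff_formalPartialSum F c 1

theorem map_formalPartialSum (φ : A →+* B) (F : FormalGroup A) (c : ℕ → A) (m : ℕ) :
    PowerSeries.map φ (formalPartialSum F c m) =
      formalPartialSum (F.map φ) (fun i => φ (c i)) m := by
  induction m with
  | zero => rw [formalPartialSum, formalPartialSum, map_zero]
  | succ m ih =>
    rw [formalPartialSum, formalPartialSum, ← ih]
    have h := map_fAdd φ F (constantCoeff_formalPartialSum F c m)
      (constantCoeff_monomial_two_pow m (c m))
    have h2 : MvPowerSeries.map φ (PowerSeries.monomial (2 ^ m) (c m)) =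
        PowerSeries.monomial (2 ^ m) (φ (c m)) := MvPowerSeries.map_monomial φ _ _
    rw [h2] at h
    exact h

theorem map_formalSum (φ : A →+* B) (F : FormalGroup A) (c : ℕ → A) :
    PowerSeries.map φ (formalSum F c) = formalSum (F.map φ) fun i => φ (c i) := by
  ext d
  rw [PowerSeries.coeff_map, formalSum, formalSum, PowerSeries.coeff_mk, PowerSeries.coeff_mk,
    ← map_formalPartialSum, PowerSeries.coeff_map]

theorem coeff_subst_monomial_twoSeries (ℓ : ℕ → A) (i : ℕ) (c : A) {d K : ℕ} (hd : d < 2 ^ K) :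
    PowerSeries.coeff d (PowerSeries.subst (PowerSeries.monomial (2 ^ i) c) (twoSeries ℓ)) =
      ∑ b ∈ range K, if d = 2 ^ (i + b) then ℓ b * c ^ 2 ^ b else 0 := by
  have h := coeff_subst_twoSeries ℓ (constantCoeff_monomial_two_pow i c) (K := K)
    (e := Finsupp.single () d) (by simpa using hd)
  refine h.trans (Finset.sum_congr rfl fun b _ => ?_)
  have h2 : MvPowerSeries.coeff (Finsupp.single () d) (PowerSeries.monomial (2 ^ i) c ^ 2 ^ b) =
      PowerSeries.coeff d (PowerSeries.monomial (2 ^ i) c ^ 2 ^ b) := rfl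
  rw [h2, PowerSeries.monomial_pow, PowerSeries.coeff_monomial, ← pow_add,
    add_comm b i, mul_ite, mul_zero]

theorem subst_formalPartialSum {F : FormalGroup A} {L : PowerSeries A}
    (hL : IsStrictHom F FormalGroup.𝔾ₐ L) (c : ℕ → A) (m : ℕ) :
    (PowerSeries.subst (formalPartialSum F c m) L : PowerSeries A) =
      ∑ i ∈ range m, (PowerSeries.subst (PowerSeries.monomial (2 ^ i) (c i)) L :
        PowerSeries A) := by
  induction m with
  | zero =>
    rw [formalPartialSum, Finset.range_zero, Finset.sum_empty]
    exact PowerSeries.subst_zero_of_constantCoeff_zero hL.constantCoeff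
  | succ m ih =>
    rw [formalPartialSum, Finset.sum_range_succ, ← ih]
    exact hL.subst_fAdd_add (constantCoeff_formalPartialSum F c m)
      (constantCoeff_monomial_two_pow m (c m))

theorem coeff_formalPartialSum {F : FormalGroup A} {ℓ : ℕ → A}
    (hL : IsStrictHom F FormalGroup.𝔾ₐ (twoSeries ℓ)) (c : ℕ → A) {m M d : ℕ} (hm : m ≤ M)
    (hd : d < 2 ^ m) : PowerSeries.coeff d (formalPartialSum F c M) =
      PowerSeries.coeff d (formalPartialSum F c m) := by
  induction M, hm using Nat.le_induction with
  | base => rfl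
  | succ M hM ih =>
    rw [← ih]
    have hdM : d < 2 ^ M := lt_of_lt_of_le hd (Nat.pow_le_pow_right (by norm_num) hM)
    refine coeff_eq_of_coeff_subst_eq hL.constantCoeff hL.coeff_one
      (constantCoeff_formalPartialSum F c _) (constantCoeff_formalPartialSum F c _) (m := 2 ^ M)
      (fun e he => ?_) (Finsupp.single () d) (by simpa using hdM)
    obtain ⟨e, rfl⟩ : ∃ d, e = Finsupp.single () d := ⟨e (), by ext; simp⟩
    change PowerSeries.coeff e (PowerSeries.subst _ _) = PowerSeries.coeff e (PowerSeries.subst _ _)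
    have he' : e < 2 ^ M := by simpa using he
    rw [subst_formalPartialSum hL, subst_formalPartialSum hL, Finset.sum_range_succ, map_add,
      coeff_subst_monomial_twoSeries ℓ M (c M) he', add_eq_left]
    refine Finset.sum_eq_zero fun b _ => if_neg ?_
    have := Nat.pow_le_pow_right (show 0 < 2 by norm_num) (Nat.le_add_right M b)
    lia

theorem subst_formalSum {F : FormalGroup A} {ℓ : ℕ → A}
    (hL : IsStrictHom F FormalGroup.𝔾ₐ (twoSeries ℓ)) (c : ℕ → A) :
    PowerSeries.subst (formalSum F c) (twoSeries ℓ) = twoSeries (star ℓ c) := by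
  ext d
  have h1 : PowerSeries.coeff d (PowerSeries.subst (formalSum F c) (twoSeries ℓ)) =
      PowerSeries.coeff d (PowerSeries.subst (formalPartialSum F c (d + 1)) (twoSeries ℓ)) := by
    refine coeff_subst_congr (constantCoeff_formalSum F c)
      (constantCoeff_formalPartialSum F c _) (m := d + 1) (fun e he => ?_) _
      (Finsupp.single () d) (by simp)
    obtain ⟨e, rfl⟩ : ∃ d, e = Finsupp.single () d := ⟨e (), by ext; simp⟩
    have he' : e < d + 1 := by simpa using he
    change PowerSeries.coeff e _ = PowerSeries.coeff e _
    rw [formalSum, PowerSeries.coeff_mk]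
    exact (coeff_formalPartialSum hL c (by lia)
      (Nat.lt_two_pow_self.trans (Nat.pow_lt_pow_right (by norm_num) (Nat.lt_succ_self e)))).symm
  have hd : d < 2 ^ (d + 1) :=
    Nat.lt_two_pow_self.trans (Nat.pow_lt_pow_right (by norm_num) (Nat.lt_succ_self d))
  rw [h1, subst_formalPartialSum hL, map_sum]
  simp only [coeff_subst_monomial_twoSeries ℓ _ _ hd]
  by_cases h : ∃ k, d = 2 ^ k
  · obtain ⟨k, rfl⟩ := h
    have hk : k < 2 ^ k := Nat.lt_two_pow_self
    rw [coeff_twoSeries_two_pow, star, ← Finset.sum_product', ← Finset.sum_filter]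
    refine Finset.sum_congr ?_ fun _ _ => rfl
    ext ⟨i, j⟩
    simp only [mem_filter, mem_product, Finset.mem_range, HasAntidiagonal.mem_antidiagonal]
    constructor
    · rintro ⟨_, h⟩
      exact (Nat.pow_right_injective le_rfl h).symm
    · rintro rfl
      exact ⟨⟨by lia, by lia⟩, rfl⟩
  · push Not at h
    rw [coeff_twoSeries_of_ne _ h]
    exact Finset.sum_eq_zero fun i _ => Finset.sum_eq_zero fun b _ => if_neg (h _)

end FormalSums

/-! ### The functional equation lemma -/

section FunctionalEquationLemma

variable {A B : Type*} [CommRing A] [CommRing B] {τ : Type*}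

/-- The extension of an endomorphism `σ` to power series raising the variables to their squares. -/
noncomputable def expandMap (τ : Type*) (σ : B →+* B) : MvPowerSeries τ B →+* MvPowerSeries τ B :=
  (MvPowerSeries.expand 2 two_ne_zero : MvPowerSeries τ B →ₐ[B] MvPowerSeries τ B).toRingHom.comp
    (MvPowerSeries.map σ)

theorem expandMap_apply (σ : B →+* B) (f : MvPowerSeries τ B) :
    expandMap τ σ f = MvPowerSeries.expand 2 two_ne_zero (MvPowerSeries.map σ f) := rfl

theorem expandMap_C (σ : B →+* B) (b : B) :
    expandMap τ σ (MvPowerSeries.C b) = MvPowerSeries.C (σ b) := by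
  rw [expandMap_apply, MvPowerSeries.map_C, MvPowerSeries.expand_C]

theorem expandMap_pow_C (σ : B →+* B) (a : ℕ) (b : B) :
    (expandMap τ σ ^ a) (MvPowerSeries.C b) = MvPowerSeries.C ((σ ^ a) b) := by
  induction a with
  | zero => rfl
  | succ a ih => simp only [pow_succ', RingHom.mul_def, RingHom.comp_apply, ih, expandMap_C]

theorem coeff_expandMap_congr (σ : B →+* B) {f g : MvPowerSeries τ B} {m : ℕ}
    (h : ∀ e : τ →₀ ℕ, e.degree < m → MvPowerSeries.coeff e f = MvPowerSeries.coeff e g)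
    (e : τ →₀ ℕ) (he : e.degree < 2 * m) :
    MvPowerSeries.coeff e (expandMap τ σ f) = MvPowerSeries.coeff e (expandMap τ σ g) := by
  rw [expandMap_apply, expandMap_apply]
  by_cases h2 : ∀ i, 2 ∣ e i
  · obtain ⟨d, rfl⟩ : ∃ d : τ →₀ ℕ, e = 2 • d := by
      refine ⟨e.mapRange (fun x => x / 2) (by simp), ?_⟩
      ext i
      simp only [Finsupp.smul_apply, Finsupp.mapRange_apply, smul_eq_mul]
      exact (Nat.mul_div_cancel' (h2 i)).symm
    rw [MvPowerSeries.coeff_expand_smul, MvPowerSeries.coeff_expand_smul, MvPowerSeries.coeff_map,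
      MvPowerSeries.coeff_map, h d]
    rw [map_nsmul, smul_eq_mul] at he
    lia
  · push Not at h2
    obtain ⟨i, hi⟩ := h2
    rw [MvPowerSeries.coeff_expand_of_not_dvd _ _ _ hi,
      MvPowerSeries.coeff_expand_of_not_dvd _ _ _ hi]

theorem coeff_expandMap_pow_congr (σ : B →+* B) {f g : MvPowerSeries τ B} {m : ℕ}
    (h : ∀ e : τ →₀ ℕ, e.degree < m → MvPowerSeries.coeff e f = MvPowerSeries.coeff e g) (a : ℕ)
    (e : τ →₀ ℕ) (he : e.degree < 2 ^ a * m) : MvPowerSeries.coeff e ((expandMap τ σ ^ a) f) =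
      MvPowerSeries.coeff e ((expandMap τ σ ^ a) g) := by
  induction a generalizing e with
  | zero => exact h e (by simpa using he)
  | succ a ih =>
    rw [pow_succ', RingHom.mul_def, RingHom.comp_apply, RingHom.comp_apply]
    exact coeff_expandMap_congr σ ih e (by rw [pow_succ'] at he; lia)

theorem two_dvd_of_map_eq_zero {f : MvPowerSeries τ A}
    (h : MvPowerSeries.map (Ideal.Quotient.mk (Ideal.span {(2 : A)})) f = 0) : 2 ∣ f := by
  have h1 : ∀ e, ∃ c, MvPowerSeries.coeff e f = 2 * c := by
    intro e
    have h2 := congrArg (MvPowerSeries.coeff e) h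
    rw [MvPowerSeries.coeff_map, map_zero, Ideal.Quotient.eq_zero_iff_mem,
      Ideal.mem_span_singleton] at h2
    exact h2
  choose c hc using h1
  let g : MvPowerSeries τ A := fun e => c e
  refine ⟨g, ?_⟩
  ext e
  rw [hc, ← map_ofNat MvPowerSeries.C 2, MvPowerSeries.coeff_C_mul]
  rfl

theorem FrobeniusLift.expandMap {φ : A →+* B} {σA : A →+* A} {σ : B →+* B}
    (H : FrobeniusLift φ σA σ) (τ : Type*) :
    FrobeniusLift (MvPowerSeries.map (σ := τ) φ) (expandMap τ σA) (expandMap τ σ) where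
  comm f := by
    rw [expandMap_apply, expandMap_apply, MvPowerSeries.map_expand, MvPowerSeries.map_map,
      MvPowerSeries.map_map]
    have h : σ.comp φ = φ.comp σA := RingHom.ext H.comm
    rw [h]
  frob f := by
    by_cases hu : IsUnit (2 : A)
    · have h : IsUnit (2 : MvPowerSeries τ A) := by
        have h1 := hu.map (MvPowerSeries.C (σ := τ) (R := A))
        rwa [map_ofNat] at h1
      exact h.dvd
    have : Fact (Nat.Prime 2) := ⟨Nat.prime_two⟩
    have hc : CharP (A ⧸ Ideal.span {(2 : A)}) 2 := by
      have h := CharP.quotient A 2 (by simpa using hu)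
      rwa [Nat.cast_ofNat] at h
    have he : ExpChar (A ⧸ Ideal.span {(2 : A)}) 2 := ExpChar.prime Nat.prime_two
    refine two_dvd_of_map_eq_zero ?_
    have hσ : (Ideal.Quotient.mk (Ideal.span {(2 : A)})).comp σA =
        (frobenius (A ⧸ Ideal.span {(2 : A)}) 2).comp (Ideal.Quotient.mk _) := by
      ext a
      rw [RingHom.comp_apply, RingHom.comp_apply, frobenius_def, ← map_pow, Ideal.Quotient.eq,
        Ideal.mem_span_singleton]
      exact H.frob a
    rw [map_sub, map_pow, expandMap_apply, MvPowerSeries.map_expand, MvPowerSeries.map_map, hσ,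
      ← MvPowerSeries.map_map, ← MvPowerSeries.map_expand, MvPowerSeries.map_frobenius_expand,
      sub_self]

theorem coeff_pow_congr_of_two_le {f g : MvPowerSeries τ A} {m : ℕ}
    (hf : MvPowerSeries.constantCoeff f = 0) (hg : MvPowerSeries.constantCoeff g = 0)
    (h : ∀ e : τ →₀ ℕ, e.degree < m → MvPowerSeries.coeff e f = MvPowerSeries.coeff e g) {d : ℕ}
    (hd : 2 ≤ d) (e : τ →₀ ℕ) (he : e.degree = m) :
    MvPowerSeries.coeff e (f ^ d) = MvPowerSeries.coeff e (g ^ d) := by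
  classical
  obtain ⟨d, rfl⟩ := Nat.exists_eq_add_of_le' hd
  have hp0 : ∀ f : MvPowerSeries τ A, MvPowerSeries.constantCoeff f = 0 →
      MvPowerSeries.coeff 0 (f ^ (d + 1)) = 0 := fun f hf => by
    rw [MvPowerSeries.coeff_zero_eq_constantCoeff_apply, map_pow, hf, zero_pow (by lia)]
  rw [show d + 2 = (d + 1) + 1 by rfl, pow_succ f (d + 1), pow_succ g (d + 1),
    MvPowerSeries.coeff_mul, MvPowerSeries.coeff_mul]
  refine Finset.sum_congr rfl fun p hp => ?_
  rw [HasAntidiagonal.mem_antidiagonal] at hp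
  have h1 : p.1.degree + p.2.degree = m := by rw [← he, ← hp, map_add]
  rcases eq_or_ne p.1 0 with h2 | h2
  · rw [h2, hp0 f hf, hp0 g hg, zero_mul, zero_mul]
  rcases eq_or_ne p.2 0 with h3 | h3
  · rw [h3, MvPowerSeries.coeff_zero_eq_constantCoeff_apply,
      MvPowerSeries.coeff_zero_eq_constantCoeff_apply, hf, hg, mul_zero, mul_zero]
  have h4 : p.1.degree ≠ 0 := fun h => h2 ((Finsupp.degree_eq_zero_iff _).1 h)
  have h5 : p.2.degree ≠ 0 := fun h => h3 ((Finsupp.degree_eq_zero_iff _).1 h)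
  rw [coeff_pow_congr h _ p.1 (by lia), h p.2 (by lia)]

theorem sum_twist_eq (σ : B →+* B) (w f : ℕ → B) (K : ℕ) :
    ∑ k ∈ range K, twist σ w f k =
      ∑ a ∈ range K, w a * (σ ^ a) (∑ b ∈ range (K - a), f b) := by
  simp only [twist, Finset.Nat.sum_antidiagonal_eq_sum_range_succ_mk, map_sum, Finset.mul_sum]
  exact Finset.sum_range_diag_flip K fun a b => w a * (σ ^ a) (f b)

variable {φ : A →+* B} {σA : A →+* A} {σ : B →+* B} {ℓ w : ℕ → B}

theorem twist_C_smul_mem (H : FrobeniusLift φ σA σ) (hw0 : w 0 = 1)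
    (hw : ∀ a, 2 * w (a + 1) ∈ φ.range) (hℓ : ∀ k, twist σ w ℓ k ∈ φ.range) (P : MvPowerSeries τ A)
    (k : ℕ) : twist (expandMap τ σ) (fun a => MvPowerSeries.C (w a))
      (fun j => MvPowerSeries.C (ℓ j) * MvPowerSeries.map φ P ^ 2 ^ j) k ∈
        (MvPowerSeries.map (σ := τ) φ).range := by
  have hC : ∀ b ∈ φ.range, MvPowerSeries.C b ∈ (MvPowerSeries.map (σ := τ) φ).range := by
    rintro _ ⟨a, rfl⟩
    exact ⟨MvPowerSeries.C a, MvPowerSeries.map_C _ _⟩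
  have hw' : ∀ a, 1 ≤ a → 2 * w a ∈ φ.range := by
    intro a h1
    obtain ⟨b, rfl⟩ := Nat.exists_eq_add_of_le' h1
    exact hw b
  have h1 := twist_smul_sub_mem (H.expandMap τ) (w := fun a => MvPowerSeries.C (w a))
    (f := fun j => MvPowerSeries.C (ℓ j)) (k := k)
    (fun a ha _ => by
      have h := hC _ (hw' a ha)
      rwa [map_mul, map_ofNat] at h)
    (fun j hj => by
      have h := hC _ (two_pow_mul_mem H (K := j + 1) hw0 (fun a h1 _ => hw' a h1)
        (fun j _ => hℓ j) j (by lia))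
      rwa [map_mul, map_pow, map_ofNat] at h) P
  have h2 : twist (expandMap τ σ) (fun a => MvPowerSeries.C (w a))
      (fun j => MvPowerSeries.C (ℓ j)) k = MvPowerSeries.C (twist σ w ℓ k) := by
    simp only [twist, expandMap_pow_C, map_sum, map_mul]
  rw [h2] at h1
  have h3 := add_mem h1 (mul_mem (pow_mem (RingHom.mem_range_self (MvPowerSeries.map φ) P) (2 ^ k))
    (hC _ (hℓ k)))
  rwa [sub_add_cancel] at h3

theorem coeff_C_mul_subst (ℓ : ℕ → B) {f : MvPowerSeries τ B}
    (hf : MvPowerSeries.constantCoeff f = 0) {K : ℕ} (e : τ →₀ ℕ) (he : e.degree < 2 ^ K) :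
    MvPowerSeries.coeff e (∑ b ∈ range K, MvPowerSeries.C (ℓ b) * f ^ 2 ^ b) =
      MvPowerSeries.coeff e (PowerSeries.subst f (twoSeries ℓ)) := by
  rw [coeff_subst_twoSeries ℓ hf he, map_sum]
  simp only [MvPowerSeries.coeff_C_mul]

theorem sum_coeff_expandMap_mem (H : FrobeniusLift φ σA σ) (hw0 : w 0 = 1)
    (hw : ∀ a, 2 * w (a + 1) ∈ φ.range) (hℓ : ∀ k, twist σ w ℓ k ∈ φ.range) {P : MvPowerSeries τ A}
    (hP : MvPowerSeries.constantCoeff P = 0) {K : ℕ} (e : τ →₀ ℕ) (he : e.degree < 2 ^ K) :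
    ∑ a ∈ range K, w a * MvPowerSeries.coeff e ((expandMap τ σ ^ a)
      (PowerSeries.subst (MvPowerSeries.map φ P) (twoSeries ℓ))) ∈ φ.range := by
  have hP' : MvPowerSeries.constantCoeff (MvPowerSeries.map φ P) = 0 := by
    rw [MvPowerSeries.constantCoeff_map, hP, map_zero]
  have h1 : ∑ k ∈ range K, twist (expandMap τ σ) (fun a => MvPowerSeries.C (w a))
      (fun j => MvPowerSeries.C (ℓ j) * MvPowerSeries.map φ P ^ 2 ^ j) k ∈
        (MvPowerSeries.map (σ := τ) φ).range :=
    sum_mem fun k _ => twist_C_smul_mem H hw0 hw hℓ P k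
  rw [sum_twist_eq] at h1
  obtain ⟨Y, hY⟩ := h1
  have h2 := congrArg (MvPowerSeries.coeff e) hY
  rw [MvPowerSeries.coeff_map, map_sum] at h2
  refine ⟨MvPowerSeries.coeff e Y, h2.trans (Finset.sum_congr rfl fun a ha => ?_)⟩
  rw [MvPowerSeries.coeff_C_mul]
  congr 1
  refine coeff_expandMap_pow_congr σ (m := 2 ^ (K - a))
    (fun e he => coeff_C_mul_subst ℓ hP' e he) a e ?_
  rw [Finset.mem_range] at ha
  rwa [← pow_add, Nat.add_sub_cancel' ha.le]

end FunctionalEquationLemma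

section IntegralFormalGroup

variable {A B : Type*} [CommRing A] [CommRing B] {τ : Type*}
variable {φ : A →+* B} {σA : A →+* A} {σ : B →+* B} {ℓ w : ℕ → B}

/-- A series whose logarithm is `log X + log Y` has integral coefficients if the logarithm
satisfies an integral functional equation. -/
theorem coeff_mem_range_of_log_add (H : FrobeniusLift φ σA σ) (hℓ0 : ℓ 0 = 1) (hw0 : w 0 = 1)
    (hw : ∀ a, 2 * w (a + 1) ∈ φ.range) (hℓ : ∀ k, twist σ w ℓ k ∈ φ.range)
    {Q : MvPowerSeries τ B} (hQ0 : MvPowerSeries.constantCoeff Q = 0) {i j : τ}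
    (hQ : PowerSeries.subst Q (twoSeries ℓ) =
      PowerSeries.subst (MvPowerSeries.X i : MvPowerSeries τ B) (twoSeries ℓ) +
        PowerSeries.subst (MvPowerSeries.X j : MvPowerSeries τ B) (twoSeries ℓ)) (e : τ →₀ ℕ) :
    MvPowerSeries.coeff e Q ∈ φ.range := by
  obtain ⟨m, hm⟩ : ∃ m, e.degree = m := ⟨_, rfl⟩
  induction m using Nat.strong_induction_on generalizing e with
  | _ m ih =>
  rcases Nat.eq_zero_or_pos m with rfl | hm0
  · rw [(Finsupp.degree_eq_zero_iff e).1 hm, MvPowerSeries.coeff_zero_eq_constantCoeff_apply, hQ0]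
    exact zero_mem _
  have hex : ∀ d : τ →₀ ℕ, ∃ a : A, φ a = if d.degree < m then MvPowerSeries.coeff d Q else 0 := by
    intro d
    split_ifs with h
    · exact ih _ h d rfl
    · exact ⟨0, map_zero _⟩
  choose p hp using hex
  let P : MvPowerSeries τ A := fun d => if d.degree = 0 then 0 else p d
  have hPc : ∀ d, MvPowerSeries.coeff d P = if d.degree = 0 then 0 else p d := fun d => rfl
  have hP0 : MvPowerSeries.constantCoeff P = 0 := by
    rw [← MvPowerSeries.coeff_zero_eq_constantCoeff_apply, hPc, if_pos (by simp)]
  have hP0' : MvPowerSeries.constantCoeff (MvPowerSeries.map φ P) = 0 := by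
    rw [MvPowerSeries.constantCoeff_map, hP0, map_zero]
  have hlow : ∀ d : τ →₀ ℕ, d.degree < m → MvPowerSeries.coeff d (MvPowerSeries.map φ P) =
      MvPowerSeries.coeff d Q := by
    intro d hd
    rw [MvPowerSeries.coeff_map, hPc]
    split_ifs with h
    · rw [(Finsupp.degree_eq_zero_iff d).1 h, MvPowerSeries.coeff_zero_eq_constantCoeff_apply, hQ0,
        map_zero]
    · rw [hp, if_pos hd]
  have he : e.degree < 2 ^ m := hm ▸ Nat.lt_two_pow_self
  have hX : ∀ i : τ, MvPowerSeries.constantCoeff (MvPowerSeries.X i : MvPowerSeries τ A) = 0 :=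
    fun i => MvPowerSeries.constantCoeff_X i
  have h1 := sum_coeff_expandMap_mem H hw0 hw hℓ hP0 e he
  have h2 := sum_coeff_expandMap_mem H hw0 hw hℓ (hX i) e he
  have h3 := sum_coeff_expandMap_mem H hw0 hw hℓ (hX j) e he
  rw [MvPowerSeries.map_X] at h2 h3
  have h4 := sub_mem h1 (add_mem h2 h3)
  simp only [← Finset.sum_add_distrib, ← Finset.sum_sub_distrib, ← mul_add, ← mul_sub, ← map_add,
    ← hQ] at h4
  obtain ⟨K, rfl⟩ := Nat.exists_eq_add_of_le' hm0
  rw [Finset.sum_range_succ', Finset.sum_eq_zero, zero_add, pow_zero, hw0, one_mul] at h4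
  · have h5 : ∀ f : MvPowerSeries τ B, MvPowerSeries.constantCoeff f = 0 →
        MvPowerSeries.coeff e (PowerSeries.subst f (twoSeries ℓ)) = MvPowerSeries.coeff e f +
          ∑ b ∈ range K, ℓ (b + 1) * MvPowerSeries.coeff e (f ^ 2 ^ (b + 1)) := by
      intro f hf
      rw [coeff_subst_twoSeries ℓ hf he, Finset.sum_range_succ', hℓ0, pow_zero, pow_one, one_mul,
        add_comm]
    simp only [RingHom.one_def, RingHom.id_apply] at h4
    rw [h5 _ hP0', h5 _ hQ0] at h4
    have h6 : ∑ b ∈ range K, ℓ (b + 1) *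
        MvPowerSeries.coeff e (MvPowerSeries.map φ P ^ 2 ^ (b + 1)) =
          ∑ b ∈ range K, ℓ (b + 1) * MvPowerSeries.coeff e (Q ^ 2 ^ (b + 1)) := by
      refine Finset.sum_congr rfl fun b _ => ?_
      rw [coeff_pow_congr_of_two_le hP0' hQ0 hlow (by
        rw [pow_succ]; have := Nat.one_le_two_pow (n := b); lia) e hm]
    rw [h6, add_sub_add_right_eq_sub] at h4
    have h7 : MvPowerSeries.coeff e (MvPowerSeries.map φ P) ∈ φ.range := by
      rw [MvPowerSeries.coeff_map]
      exact RingHom.mem_range_self _ _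
    have h8 := sub_mem h7 h4
    rwa [sub_sub_cancel] at h8
  · intro a _
    rw [sub_eq_zero_of_eq, mul_zero]
    refine coeff_expandMap_pow_congr σ (coeff_subst_congr hP0' hQ0 hlow _) (a + 1) e ?_
    rw [hm, pow_succ]
    have := Nat.one_le_two_pow (n := a)
    nlinarith

theorem map_injective_of_injective (hφ : Function.Injective φ) :
    Function.Injective (MvPowerSeries.map (σ := τ) φ) := by
  intro f g h
  ext e
  apply hφ
  rw [← MvPowerSeries.coeff_map, h, MvPowerSeries.coeff_map]

theorem isComm_of_log (hφ : Function.Injective φ) {F : FormalGroup A} {L : PowerSeries B}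
    (hL : IsStrictHom (F.map φ) FormalGroup.𝔾ₐ L) : F.IsComm := by
  have hX : ∀ i : Fin 2, MvPowerSeries.constantCoeff (MvPowerSeries.X i : MvPowerSeries _ A) = 0 :=
    fun i => MvPowerSeries.constantCoeff_X i
  have hX' : ∀ i : Fin 2, MvPowerSeries.constantCoeff (MvPowerSeries.X i : MvPowerSeries _ B) = 0 :=
    fun i => MvPowerSeries.constantCoeff_X i
  refine ⟨map_injective_of_injective hφ ?_⟩
  refine subst_injective hL.constantCoeff hL.coeff_one ?_ ?_ ?_
  · exact (F.map φ).zero_constantCoeff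
  · rw [MvPowerSeries.constantCoeff_map]
    exact (congrArg φ (constantCoeff_fAdd F (hX 1) (hX 0))).trans (map_zero φ)
  · have h1 := map_fAdd φ F (hX 1) (hX 0)
    rw [MvPowerSeries.map_X, MvPowerSeries.map_X] at h1
    rw [fAdd] at h1
    rw [h1, hL.subst_fAdd_add (hX' 1) (hX' 0), add_comm]
    exact hL.subst_hom_add

theorem constantCoeff_subst_pair {T : MvPowerSeries (Fin 2) A} {f g : MvPowerSeries τ A}
    (hT : MvPowerSeries.constantCoeff T = 0) (hf : MvPowerSeries.constantCoeff f = 0)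
    (hg : MvPowerSeries.constantCoeff g = 0) :
    MvPowerSeries.constantCoeff (MvPowerSeries.subst ![f, g] T) = 0 :=
  MvPowerSeries.constantCoeff_subst_eq_zero (hasSubst_pair hf hg)
    (fun s => by fin_cases s <;> simpa) hT

/-- The functional equation lemma: existence of an integral formal group law with a given
logarithm. -/
theorem exists_formalGroup_of_log (hφ : Function.Injective φ) (H : FrobeniusLift φ σA σ)
    (hℓ0 : ℓ 0 = 1) (hw0 : w 0 = 1) (hw : ∀ a, 2 * w (a + 1) ∈ φ.range)
    (hℓ : ∀ k, twist σ w ℓ k ∈ φ.range) :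
    ∃ F : FormalGroup A, IsStrictHom (F.map φ) FormalGroup.𝔾ₐ (twoSeries ℓ) := by
  have hL0 := constantCoeff_twoSeries ℓ
  have hL1 : PowerSeries.coeff 1 (twoSeries ℓ) = 1 := by
    rw [← hℓ0, ← coeff_twoSeries_two_pow ℓ 0, pow_zero]
  obtain ⟨M, hM0, hM, hM'⟩ := exists_inverse hL0 hL1
  have hX : ∀ i : Fin 2, MvPowerSeries.constantCoeff (MvPowerSeries.X i : MvPowerSeries _ B) = 0 :=
    fun i => MvPowerSeries.constantCoeff_X i
  set S : MvPowerSeries (Fin 2) B :=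
    PowerSeries.subst (MvPowerSeries.X 0 : MvPowerSeries (Fin 2) B) (twoSeries ℓ) +
      PowerSeries.subst (MvPowerSeries.X 1 : MvPowerSeries (Fin 2) B) (twoSeries ℓ) with hS
  have hS0 : MvPowerSeries.constantCoeff S = 0 := by
    rw [hS, map_add, constantCoeff_subst_zero (hX 0) hL0, constantCoeff_subst_zero (hX 1) hL0,
      add_zero]
  have hQ0 : MvPowerSeries.constantCoeff (PowerSeries.subst S M) = 0 :=
    constantCoeff_subst_zero hS0 hM0
  have hQ : PowerSeries.subst (PowerSeries.subst S M) (twoSeries ℓ) = S := by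
    rw [← subst_subst hS0 hM0, hM', PowerSeries.subst_X (.of_constantCoeff_zero hS0)]
  choose p hp using coeff_mem_range_of_log_add H hℓ0 hw0 hw hℓ hQ0 hQ
  let P : MvPowerSeries (Fin 2) A := fun e => p e
  have hPQ : MvPowerSeries.map φ P = PowerSeries.subst S M := by
    ext e
    rw [MvPowerSeries.coeff_map, ← hp]
    rfl
  rw [← hPQ] at hQ hQ0
  have hP0 : MvPowerSeries.constantCoeff P = 0 := by
    apply hφ
    rw [← MvPowerSeries.constantCoeff_map, hQ0, map_zero]
  have hlin : ∀ i, MvPowerSeries.coeff (Finsupp.single i 1) P = 1 := by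
    intro i
    have h1 := congrArg (MvPowerSeries.coeff (Finsupp.single i 1)) hQ
    rw [coeff_subst_twoSeries ℓ hQ0 (K := 1) (by simp), Finset.sum_range_one, hℓ0, one_mul,
      pow_zero, pow_one, hS, map_add, PowerSeries.coeff_subst_single,
      PowerSeries.coeff_subst_single, MvPowerSeries.coeff_map] at h1
    apply hφ
    rw [h1, map_one φ]
    fin_cases i <;> simp [hL1]
  have hadd : ∀ {υ : Type} (f g : MvPowerSeries υ B), MvPowerSeries.constantCoeff f = 0 →
      MvPowerSeries.constantCoeff g = 0 →
      PowerSeries.subst (MvPowerSeries.subst ![f, g] (MvPowerSeries.map φ P)) (twoSeries ℓ) =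
        PowerSeries.subst f (twoSeries ℓ) + PowerSeries.subst g (twoSeries ℓ) := by
    intro υ f g hf hg
    have hfg := hasSubst_pair hf hg
    rw [← mvSubst_subst hQ0 hfg, hQ, hS, MvPowerSeries.subst_add hfg, mvSubst_subst (hX 0) hfg,
      mvSubst_subst (hX 1) hfg, MvPowerSeries.subst_X hfg, MvPowerSeries.subst_X hfg]
    rfl
  have hmap : ∀ {υ : Type} (f g : MvPowerSeries υ A), MvPowerSeries.constantCoeff f = 0 →
      MvPowerSeries.constantCoeff g = 0 → MvPowerSeries.map φ (MvPowerSeries.subst ![f, g] P) =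
        MvPowerSeries.subst ![MvPowerSeries.map φ f, MvPowerSeries.map φ g]
          (MvPowerSeries.map φ P) := by
    intro υ f g hf hg
    rw [MvPowerSeries.map_subst (hasSubst_pair hf hg)]
    congr 1
    funext i
    fin_cases i <;> rfl
  have hY : ∀ i : Fin 3, MvPowerSeries.constantCoeff (MvPowerSeries.X i : MvPowerSeries _ A) = 0 :=
    fun i => MvPowerSeries.constantCoeff_X i
  have hY' : ∀ i : Fin 3, MvPowerSeries.constantCoeff (MvPowerSeries.X i : MvPowerSeries _ B) = 0 :=
    fun i => MvPowerSeries.constantCoeff_X i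
  refine ⟨⟨P, hP0, hlin 0, hlin 1, ?_⟩, ?_⟩
  · refine map_injective_of_injective hφ ?_
    have a01 := constantCoeff_subst_pair hP0 (hY 0) (hY 1)
    have a12 := constantCoeff_subst_pair hP0 (hY 1) (hY 2)
    have b01 := constantCoeff_subst_pair hQ0 (hY' 0) (hY' 1)
    have b12 := constantCoeff_subst_pair hQ0 (hY' 1) (hY' 2)
    rw [hmap _ _ a01 (hY 2), hmap _ _ (hY 0) a12, hmap _ _ (hY 0) (hY 1), hmap _ _ (hY 1) (hY 2),
      MvPowerSeries.map_X, MvPowerSeries.map_X, MvPowerSeries.map_X]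
    refine subst_injective hL0 hL1 (constantCoeff_subst_pair hQ0 b01 (hY' 2)) (constantCoeff_subst_pair hQ0 (hY' 0) b12) ?_
    rw [hadd _ _ b01 (hY' 2), hadd _ _ (hY' 0) b12, hadd _ _ (hY' 0) (hY' 1),
      hadd _ _ (hY' 1) (hY' 2), add_assoc]
  · refine ⟨?_, hL1, ?_⟩
    · rw [PowerSeries.coeff_zero_eq_constantCoeff_apply]
      exact hL0
    · rw [fAdd_add (constantCoeff_subst_zero (hX 0) hL0) (constantCoeff_subst_zero (hX 1) hL0)]
      exact hQ

end IntegralFormalGroup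

/-! ### The canonical formal group law in terms of logarithm coefficients -/

section Translation

variable {A B : Type*} [CommRing A] [CommRing B] {τ : Type*}

theorem twoSeries_add (f g : ℕ → A) :
    twoSeries (fun k => f k + g k) = twoSeries f + twoSeries g := by
  ext d
  simp only [twoSeries, map_add, PowerSeries.coeff_mk]
  split_ifs <;> simp

theorem twoSeries_zero : twoSeries (fun _ => (0 : A)) = 0 := by
  ext d
  simp [twoSeries]

theorem coeff_one_twoSeries (ℓ : ℕ → A) : PowerSeries.coeff 1 (twoSeries ℓ) = ℓ 0 := by
  simpa using coeff_twoSeries_two_pow ℓ 0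

/-- The coefficients of `f (-x)` for `f = ∑ i, f i * x ^ (2 ^ i)`. -/
def negFirst (f : ℕ → A) : ℕ → A
  | 0 => - f 0
  | k + 1 => f (k + 1)

theorem subst_neg_twoSeries (ℓ : ℕ → A) {f : MvPowerSeries τ A}
    (hf : MvPowerSeries.constantCoeff f = 0) :
    PowerSeries.subst (-f) (twoSeries ℓ) = PowerSeries.subst f (twoSeries (negFirst ℓ)) := by
  have hf' : MvPowerSeries.constantCoeff (-f) = 0 := by rw [map_neg, hf, neg_zero]
  ext e
  have he : e.degree < 2 ^ (e.degree + 1) :=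
    Nat.lt_two_pow_self.trans (Nat.pow_lt_pow_right (by norm_num) (Nat.lt_succ_self _))
  rw [coeff_subst_twoSeries ℓ hf' he, coeff_subst_twoSeries _ hf he]
  refine Finset.sum_congr rfl fun b _ => ?_
  rcases b with _ | b
  · simp [negFirst]
  · rw [Even.neg_pow (by simp [Nat.even_pow]), negFirst]

theorem IsStrictHom.comp {F G H : FormalGroup A} {ψ χ : PowerSeries A} (hψ : IsStrictHom F G ψ)
    (hχ : IsStrictHom G H χ) : IsStrictHom F H (PowerSeries.subst ψ χ) where
  coeff_zero := by
    rw [PowerSeries.coeff_zero_eq_constantCoeff_apply]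
    exact constantCoeff_subst_zero hψ.constantCoeff hχ.constantCoeff
  coeff_one := by rw [coeff_one_subst hψ.constantCoeff, hψ.coeff_one, hχ.coeff_one, mul_one]
  hom := by
    have hX : ∀ i : Fin 2, MvPowerSeries.constantCoeff (MvPowerSeries.X i : MvPowerSeries _ A) = 0 :=
      fun i => MvPowerSeries.constantCoeff_X i
    rw [subst_subst F.zero_constantCoeff hψ.constantCoeff, hψ.hom,
      hχ.subst_fAdd (constantCoeff_subst_zero (hX 0) hψ.constantCoeff)
        (constantCoeff_subst_zero (hX 1) hψ.constantCoeff),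
      subst_subst (hX 0) hψ.constantCoeff, subst_subst (hX 1) hψ.constantCoeff]

/-- A series intertwining the logarithms is a strict homomorphism. -/
theorem isStrictHom_of_log {φ : A →+* B} (hφ : Function.Injective φ) {F G : FormalGroup A}
    {L M : PowerSeries B} (hL : IsStrictHom (F.map φ) FormalGroup.𝔾ₐ L)
    (hM : IsStrictHom (G.map φ) FormalGroup.𝔾ₐ M) {ψ : PowerSeries A}
    (hψ0 : MvPowerSeries.constantCoeff ψ = 0)
    (hψ : PowerSeries.subst (PowerSeries.map φ ψ) M = L) : IsStrictHom F G ψ := by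
  have hX : ∀ i : Fin 2, MvPowerSeries.constantCoeff (MvPowerSeries.X i : MvPowerSeries _ A) = 0 :=
    fun i => MvPowerSeries.constantCoeff_X i
  have hX' : ∀ i : Fin 2, MvPowerSeries.constantCoeff (MvPowerSeries.X i : MvPowerSeries _ B) = 0 :=
    fun i => MvPowerSeries.constantCoeff_X i
  have hψ0' : MvPowerSeries.constantCoeff (PowerSeries.map φ ψ) = 0 :=
    (MvPowerSeries.constantCoeff_map φ ψ).trans (by rw [hψ0, map_zero])
  have hF0 := (F.map φ).zero_constantCoeff
  have hψX : ∀ i : Fin 2, MvPowerSeries.map φ (PowerSeries.subst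
      (MvPowerSeries.X i : MvPowerSeries _ A) ψ) =
        PowerSeries.subst (MvPowerSeries.X i : MvPowerSeries _ B) (PowerSeries.map φ ψ) := by
    intro i
    rw [PowerSeries.map_subst (.of_constantCoeff_zero (hX i)), MvPowerSeries.map_X]
  have hc := fun i => constantCoeff_subst_zero (hX i) hψ0
  have hc' := fun i => constantCoeff_subst_zero (hX' i) hψ0'
  refine ⟨?_, ?_, map_injective_of_injective hφ ?_⟩
  · rw [PowerSeries.coeff_zero_eq_constantCoeff_apply]
    exact hψ0
  · apply hφ
    have h := congrArg (PowerSeries.coeff 1) hψ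
    rwa [coeff_one_subst hψ0', hM.coeff_one, hL.coeff_one, one_mul, PowerSeries.coeff_map,
      ← map_one φ] at h
  · rw [PowerSeries.map_subst (.of_constantCoeff_zero F.zero_constantCoeff),
      map_fAdd φ G (hc 0) (hc 1), hψX, hψX]
    refine subst_injective hM.constantCoeff hM.coeff_one (constantCoeff_subst_zero hF0 hψ0')
      (constantCoeff_fAdd _ (hc' 0) (hc' 1)) ?_
    rw [hM.subst_fAdd_add (hc' 0) (hc' 1), ← subst_subst (hX' 0) hψ0', ← subst_subst (hX' 1) hψ0',
      ← subst_subst (f := MvPowerSeries.map φ F.toPowerSeries) hF0 hψ0', hψ]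
    exact hL.subst_hom_add

variable {n : ℕ} {F : FormalGroup (R n)} {ℓ : ℕ → RQ n}

theorem IsLogCoeffs.zero (h : IsLogCoeffs F ℓ) : ℓ 0 = 1 := by
  have h1 := h.coeff_one
  rwa [coeff_one_twoSeries] at h1

theorem comp_gamma_pow (s : ℕ) : (algebraMap (R n) (RQ n)).comp
      ((gamma n Z2 ^ s : R n ≃ₐ[Z2] R n) : R n →+* R n) =
    ((gamma n ℚ ^ s : RQ n ≃ₐ[ℚ] RQ n) : RQ n →+* RQ n).comp (algebraMap (R n) (RQ n)) :=
  RingHom.ext fun x => (gamma_pow_algebraMap n s x).symm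

theorem IsLogCoeffs.conj (h : IsLogCoeffs F ℓ) :
    IsLogCoeffs (conj F) fun k => gamma n ℚ (ℓ k) := by
  have h1 := IsStrictHom.map ((gamma n ℚ : RQ n ≃ₐ[ℚ] RQ n) : RQ n →+* RQ n) h
  rw [additiveGroup_map, map_twoSeries] at h1
  have h2 : (EquivariantBP.conj F).map (algebraMap (R n) (RQ n)) =
      (F.map (algebraMap (R n) (RQ n))).map ((gamma n ℚ : RQ n ≃ₐ[ℚ] RQ n) : RQ n →+* RQ n) := by
    have h3 := comp_gamma_pow (n := n) 1
    rw [pow_one, pow_one] at h3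
    ext1
    simp only [EquivariantBP.conj, FormalGroup.map_toPowerSeries, MvPowerSeries.map_map, h3]
  rw [IsLogCoeffs, h2]
  exact h1

theorem IsLogCoeffs.subst_psi (h : IsLogCoeffs F ℓ) :
    PowerSeries.subst (PowerSeries.map (algebraMap (R n) (RQ n)) (psi F))
      (twoSeries fun k => gamma n ℚ (ℓ k)) =
        twoSeries (star (fun k => gamma n ℚ (ℓ k)) fun i => algebraMap (R n) (RQ n) (t n i)) := by
  rw [psi, map_formalSum]
  exact subst_formalSum h.conj _

theorem constantCoeff_psi (F : FormalGroup (R n)) : MvPowerSeries.constantCoeff (psi F) = 0 :=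
  constantCoeff_formalSum _ _

theorem isStrictHom_psi_iff (h : IsLogCoeffs F ℓ) : IsStrictHom F (conj F) (psi F) ↔
    ℓ = star (fun k => gamma n ℚ (ℓ k)) fun i => algebraMap (R n) (RQ n) (t n i) := by
  constructor
  · intro hψ
    have h1 := log_unique h ((hψ.map (algebraMap (R n) (RQ n))).comp h.conj)
    rw [h.subst_psi] at h1
    exact twoSeries_injective h1
  · intro hℓ
    refine isStrictHom_of_log (algebraMap_injective n) h h.conj (constantCoeff_psi F) ?_
    rw [h.subst_psi, ← hℓ]

theorem constantCoeff_powerSeries_map (φ : A →+* B) {P : PowerSeries A}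
    (h : MvPowerSeries.constantCoeff P = 0) :
    MvPowerSeries.constantCoeff (PowerSeries.map φ P) = 0 :=
  (MvPowerSeries.constantCoeff_map φ P).trans (by rw [h, map_zero])

theorem constantCoeff_psiComp (F : FormalGroup (R n)) (s : ℕ) :
    MvPowerSeries.constantCoeff (psiComp F s) = 0 := by
  induction s with
  | zero => exact MvPowerSeries.constantCoeff_X _
  | succ s ih =>
    exact constantCoeff_subst_zero ih (constantCoeff_powerSeries_map _ (constantCoeff_psi F))

theorem powerSeries_map_subst (φ : A →+* B) {P Q : PowerSeries A}
    (hP : MvPowerSeries.constantCoeff P = 0) :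
    PowerSeries.map φ (PowerSeries.subst P Q) =
      PowerSeries.subst (PowerSeries.map φ P) (PowerSeries.map φ Q) :=
  PowerSeries.map_subst (.of_constantCoeff_zero hP) Q

theorem IsLogCoeffs.subst_psiComp (h : IsLogCoeffs F ℓ)
    (hℓ : ℓ = star (fun k => gamma n ℚ (ℓ k)) fun i => algebraMap (R n) (RQ n) (t n i)) (s : ℕ) :
    PowerSeries.subst (PowerSeries.map (algebraMap (R n) (RQ n)) (psiComp F s))
      (twoSeries fun k => (gamma n ℚ ^ s) (ℓ k)) = twoSeries ℓ := by
  induction s with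
  | zero =>
    rw [psiComp, PowerSeries.map_X]
    exact PowerSeries.X_subst _
  | succ s ih =>
    have h1 := h.subst_psi
    rw [← hℓ] at h1
    have h0 := constantCoeff_psi F
    have hc := constantCoeff_powerSeries_map (algebraMap (R n) (RQ n)) (constantCoeff_psiComp F s)
    have hc' := constantCoeff_powerSeries_map (algebraMap (R n) (RQ n)) h0
    have h2 := congrArg (PowerSeries.map ((gamma n ℚ ^ s : RQ n ≃ₐ[ℚ] RQ n) : RQ n →+* RQ n)) h1
    rw [powerSeries_map_subst _ hc', map_twoSeries, map_twoSeries] at h2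
    have h3 : PowerSeries.map ((gamma n ℚ ^ s : RQ n ≃ₐ[ℚ] RQ n) : RQ n →+* RQ n)
        (PowerSeries.map (algebraMap (R n) (RQ n)) (psi F)) =
        PowerSeries.map (algebraMap (R n) (RQ n))
          (PowerSeries.map ((gamma n Z2 ^ s : R n ≃ₐ[Z2] R n) : R n →+* R n) (psi F)) := by
      ext1 d
      simp only [PowerSeries.coeff_map]
      exact gamma_pow_algebraMap n s _
    rw [h3] at h2
    have hc'' := constantCoeff_powerSeries_map (algebraMap (R n) (RQ n))
      (constantCoeff_powerSeries_map ((gamma n Z2 ^ s : R n ≃ₐ[Z2] R n) : R n →+* R n) h0)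
    rw [psiComp, powerSeries_map_subst _ (constantCoeff_psiComp F s), ← subst_subst hc hc'']
    have h4 : (twoSeries fun k => (gamma n ℚ ^ (s + 1)) (ℓ k)) = twoSeries fun k =>
        ((gamma n ℚ ^ s : RQ n ≃ₐ[ℚ] RQ n) : RQ n →+* RQ n) (gamma n ℚ (ℓ k)) := by
      congr 1
    rw [h4, h2]
    exact ih

theorem isInversion_psiComp_iff (h : IsLogCoeffs F ℓ)
    (hℓ : ℓ = star (fun k => gamma n ℚ (ℓ k)) fun i => algebraMap (R n) (RQ n) (t n i)) (s : ℕ) :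
    IsInversion F (- psiComp F s) ↔ ∀ k, (gamma n ℚ ^ s) (ℓ (k + 1)) = - ℓ (k + 1) := by
  set P := PowerSeries.map (algebraMap (R n) (RQ n)) (psiComp F s) with hPdef
  have hp0 := constantCoeff_psiComp F s
  have hn0 : MvPowerSeries.constantCoeff (- psiComp F s) = 0 :=
    (map_neg MvPowerSeries.constantCoeff _).trans (by rw [hp0, neg_zero])
  have hP0 : MvPowerSeries.constantCoeff P = 0 := constantCoeff_powerSeries_map _ hp0
  have hX : MvPowerSeries.constantCoeff (PowerSeries.X : PowerSeries (R n)) = 0 :=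
    MvPowerSeries.constantCoeff_X _
  have hX' : MvPowerSeries.constantCoeff (PowerSeries.X : PowerSeries (RQ n)) = 0 :=
    MvPowerSeries.constantCoeff_X _
  have hsub := h.subst_psiComp hℓ s
  rw [← hPdef] at hsub
  have hP1 : PowerSeries.coeff 1 P = 1 := by
    have h1 := congrArg (PowerSeries.coeff 1) hsub
    rw [coeff_one_subst hP0, h.coeff_one, coeff_one_twoSeries, h.zero, map_one, one_mul] at h1
    exact h1
  have hnP0 : MvPowerSeries.constantCoeff (-P) = 0 :=
    (map_neg MvPowerSeries.constantCoeff P).trans (by rw [hP0, neg_zero])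
  have hmap : PowerSeries.map (algebraMap (R n) (RQ n)) (fAdd F PowerSeries.X (- psiComp F s)) =
      fAdd (F.map (algebraMap (R n) (RQ n))) PowerSeries.X (-P) := by
    have h1 := map_fAdd (algebraMap (R n) (RQ n)) F hX hn0
    have h2 : MvPowerSeries.map (algebraMap (R n) (RQ n)) (PowerSeries.X : PowerSeries (R n)) =
      PowerSeries.X := PowerSeries.map_X _
    have h3 : MvPowerSeries.map (algebraMap (R n) (RQ n)) (- psiComp F s) = -P :=
      map_neg (PowerSeries.map (algebraMap (R n) (RQ n))) _
    rw [h2, h3] at h1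
    exact h1
  have hlog : PowerSeries.subst (fAdd (F.map (algebraMap (R n) (RQ n))) PowerSeries.X (-P))
      (twoSeries ℓ) = (PowerSeries.subst P
        (twoSeries fun k => (gamma n ℚ ^ s) (ℓ k) + negFirst ℓ k) : PowerSeries (RQ n)) := by
    have h1 := IsStrictHom.subst_fAdd_add h hX' hnP0
    have h2 := subst_neg_twoSeries ℓ hP0
    rw [h2] at h1
    have h3 : (PowerSeries.subst (PowerSeries.X : PowerSeries (RQ n)) (twoSeries ℓ)) =
      twoSeries ℓ := PowerSeries.X_subst _
    rw [twoSeries_add, PowerSeries.subst_add (.of_constantCoeff_zero hP0), hsub]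
    refine h1.trans ?_
    congr 1
  have key : fAdd F PowerSeries.X (- psiComp F s) = 0 ↔
      (fun k => (gamma n ℚ ^ s) (ℓ k) + negFirst ℓ k) = fun _ => 0 := by
    constructor
    · intro h1
      rw [h1, map_zero] at hmap
      rw [← hmap] at hlog
      have h2 : PowerSeries.subst (0 : PowerSeries (RQ n)) (twoSeries ℓ) = (0 : PowerSeries _) :=
        PowerSeries.subst_zero_of_constantCoeff_zero h.constantCoeff
      rw [h2] at hlog
      obtain ⟨M, hM0, -, hM⟩ := exists_inverse hP0 hP1
      have h3 := congrArg (PowerSeries.subst M) hlog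
      apply twoSeries_injective
      rw [subst_subst hM0 hP0, hM, ← PowerSeries.coe_substAlgHom (.of_constantCoeff_zero hM0),
        map_zero] at h3
      rw [twoSeries_zero, h3]
      exact (PowerSeries.X_subst _).symm
    · intro h1
      rw [h1, twoSeries_zero] at hlog
      have h2 : PowerSeries.subst P (0 : PowerSeries (RQ n)) = (0 : PowerSeries (RQ n)) := by
        rw [← PowerSeries.coe_substAlgHom (.of_constantCoeff_zero hP0), map_zero]
      have h3 : PowerSeries.subst (0 : PowerSeries (RQ n)) (twoSeries ℓ) = (0 : PowerSeries _) :=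
        PowerSeries.subst_zero_of_constantCoeff_zero h.constantCoeff
      rw [h2, ← h3] at hlog
      have h4 := subst_injective h.constantCoeff h.coeff_one (constantCoeff_fAdd _ hX' hnP0)
        (map_zero _) hlog
      rw [← hmap] at h4
      exact PowerSeries.map_injective _ (algebraMap_injective n) (h4.trans (map_zero _).symm)
  rw [IsInversion, key]
  constructor
  · rintro ⟨-, h1⟩ k
    exact eq_neg_of_add_eq_zero_left (congrFun h1 (k + 1))
  · intro h1
    refine ⟨?_, funext fun k => ?_⟩
    · rw [PowerSeries.coeff_zero_eq_constantCoeff_apply]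
      exact hn0
    · rcases k with _ | k
      · simp only [negFirst, h.zero, map_one, add_neg_cancel]
      · simp only [negFirst, h1, neg_add_cancel]

theorem isAraki_iff (h : IsLogCoeffs F ℓ) (v : ℕ → R n) : IsAraki F v ↔ IsArakiSystem ℓ v := by
  have hX : MvPowerSeries.constantCoeff (PowerSeries.X : PowerSeries (R n)) = 0 :=
    MvPowerSeries.constantCoeff_X _
  have hX' : MvPowerSeries.constantCoeff (PowerSeries.X : PowerSeries (RQ n)) = 0 :=
    MvPowerSeries.constantCoeff_X _
  have hmap : PowerSeries.map (algebraMap (R n) (RQ n)) (fAdd F PowerSeries.X PowerSeries.X) =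
      fAdd (F.map (algebraMap (R n) (RQ n))) PowerSeries.X PowerSeries.X := by
    have h1 := map_fAdd (algebraMap (R n) (RQ n)) F hX hX
    have h2 : MvPowerSeries.map (algebraMap (R n) (RQ n)) (PowerSeries.X : PowerSeries (R n)) =
      PowerSeries.X := PowerSeries.map_X _
    rw [h2] at h1
    exact h1
  have hL : PowerSeries.subst (fAdd (F.map (algebraMap (R n) (RQ n))) PowerSeries.X PowerSeries.X)
      (twoSeries ℓ) = twoSeries fun k => 2 * ℓ k := by
    simp only [two_mul]
    rw [twoSeries_add]
    have h1 := IsStrictHom.subst_fAdd_add h hX' hX'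
    have h3 : (PowerSeries.subst (PowerSeries.X : PowerSeries (RQ n)) (twoSeries ℓ)) =
      twoSeries ℓ := PowerSeries.X_subst _
    exact h1.trans (congrArg₂ (· + ·) h3 h3)
  have hR := subst_formalSum h fun i => algebraMap (R n) (RQ n) (v i)
  rw [← map_formalSum] at hR
  rw [← hmap] at hL
  constructor
  · intro h1 k
    rw [IsAraki] at h1
    rw [h1, hR] at hL
    exact congrFun (twoSeries_injective hL) k
  · intro h1
    have h2 : star ℓ (fun i => algebraMap (R n) (RQ n) (v i)) = fun k => 2 * ℓ k := funext h1
    rw [h2, ← hL] at hR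
    refine PowerSeries.map_injective _ (algebraMap_injective n) ?_
    exact subst_injective h.constantCoeff h.coeff_one
      (constantCoeff_powerSeries_map _ (constantCoeff_fAdd F hX hX))
      (constantCoeff_powerSeries_map _ (constantCoeff_formalSum F v)) hR.symm

theorem IsCanonicalLaw.isLogSystem (hF : IsCanonicalLaw n F) (h : IsLogCoeffs F ℓ) :
    IsLogSystem ℓ := by
  have h1 := (isStrictHom_psi_iff h).1 hF.strict
  exact ⟨h.zero, fun k => congrFun h1 k, (isInversion_psiComp_iff h h1 _).1 hF.inversion⟩

theorem IsLogSystem.isCanonicalLaw (hℓ : IsLogSystem ℓ) (h : IsLogCoeffs F ℓ) :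
    IsCanonicalLaw n F := by
  have h1 := funext hℓ.strict
  exact ⟨isComm_of_log (algebraMap_injective n) h, ⟨ℓ, h⟩, (isStrictHom_psi_iff h).2 h1,
    (isInversion_psiComp_iff h h1 _).2 hℓ.neg⟩

variable (n) in
theorem exists_isLogCoeffs : ∃ F : FormalGroup (R n), IsLogCoeffs F (logCoeff n) :=
  exists_formalGroup_of_log (algebraMap_injective n) (frobeniusLift n) (logCoeff_zero n)
    (logWeight_zero n) (two_mul_logWeight_mem n) (twist_logCoeff_mem n)

theorem eq_of_isLogCoeffs {G : FormalGroup (R n)} (hF : IsLogCoeffs F ℓ) (hG : IsLogCoeffs G ℓ) :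
    F = G := by
  have h1 := congrArg FormalGroup.toPowerSeries (formalGroup_eq_of_log hF hG)
  exact FormalGroup.ext (map_injective_of_injective (algebraMap_injective n) h1)

end Translation

end EquivariantBP

theorem mainTheorem9 (n : ℕ) (hn : 1 ≤ n) :
    (∃! F : FormalGroup (EquivariantBP.R n), EquivariantBP.IsCanonicalLaw n F) ∧
    ∀ F : FormalGroup (EquivariantBP.R n), EquivariantBP.IsCanonicalLaw n F →
      (∃! ℓ : ℕ → EquivariantBP.RQ n, EquivariantBP.IsLogCoeffs F ℓ) ∧
      (∃! v : ℕ → EquivariantBP.R n, EquivariantBP.IsAraki F v) ∧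
      ∀ (ℓ : ℕ → EquivariantBP.RQ n) (v : ℕ → EquivariantBP.R n),
        EquivariantBP.IsLogCoeffs F ℓ → EquivariantBP.IsAraki F v →
        ∀ k : ℕ, 1 ≤ k →
          v k - EquivariantBP.gamma n EquivariantBP.Z2 (v k) ∈ EquivariantBP.idealI v k ∧
          (∀ g ∈ Subgroup.zpowers (EquivariantBP.gamma n EquivariantBP.Z2),
            (EquivariantBP.idealI v k).map g = EquivariantBP.idealI v k) ∧
          ∀ r : ℕ, 1 ≤ r → r ≤ n →
            (EquivariantBP.moduleL ℓ (EquivariantBP.gammaSub n ℚ r) k).comap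
              (Algebra.linearMap (EquivariantBP.R n) (EquivariantBP.RQ n)) =
            EquivariantBP.idealI v k := by
  have hlog : ∀ F : FormalGroup (EquivariantBP.R n), EquivariantBP.IsCanonicalLaw n F →
      EquivariantBP.IsLogCoeffs F (EquivariantBP.logCoeff n) := by
    intro F hF
    obtain ⟨ℓ, hℓ⟩ := hF.typical
    rwa [← (hF.isLogSystem hℓ).eq_logCoeff]
  refine ⟨?_, fun F hF => ⟨?_, ?_, ?_⟩⟩
  · obtain ⟨F, hF⟩ := EquivariantBP.exists_isLogCoeffs n
    exact ⟨F, (EquivariantBP.isLogSystem_logCoeff n).isCanonicalLaw hF, fun G hG =>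
      EquivariantBP.eq_of_isLogCoeffs (hlog G hG) hF⟩
  · exact ⟨_, hlog F hF, fun ℓ hℓ => (hF.isLogSystem hℓ).eq_logCoeff⟩
  · have hL := hlog F hF
    obtain ⟨v, hv⟩ := EquivariantBP.exists_araki n
    refine ⟨v, (EquivariantBP.isAraki_iff hL v).2 hv, fun u hu => ?_⟩
    have hu' := (EquivariantBP.isAraki_iff hL u).1 hu
    have h1 := EquivariantBP.star_left_injective (EquivariantBP.logCoeff_zero n)
      (fun k => (hu' k).trans (hv k).symm)
    exact funext fun i => EquivariantBP.algebraMap_injective n (congrFun h1 i)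
  · intro ℓ v hℓ hv k hk
    obtain ⟨k, rfl⟩ := Nat.exists_eq_add_of_le' hk
    have hs := hF.isLogSystem hℓ
    have hv' := (EquivariantBP.isAraki_iff hℓ v).1 hv
    exact ⟨EquivariantBP.sub_gamma_mem hs hv' (EquivariantBP.gamma_mem_idealI hs hv' k),
      fun g hg => EquivariantBP.map_idealI_of_mem_zpowers hs hv' k hg,
      fun r _ _ => EquivariantBP.comap_moduleL hs hv' k _⟩
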